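/- \textbf{Theorem.} Every language recognized by the calculus $\mathbf{L}^{*}\Diamond$ (the Lambek calculus with brackets, allowing empty antecedents) is context-free. Here \emph{types} are built from primitive types $p_1,p_2,\dots$ by $A\backslash B$, $B/A$, $A\bullet B$, $\Diamond A$, $\Box^{\downarrow}A$. A \emph{type tree} is a type or an expression $\langle\Gamma\rangle$ with $\Gamma$ a \emph{type hedge}, that is, a finite (possibly empty) sequence of type trees. The \emph{yield} of a hedge is the string of types obtained by erasing all brackets. A \emph{context} $\Gamma[\blacksquare]$ is a hedge with exactly one leaf labelled by a hole $\blacksquare$ (all other leaves being types), and $\Gamma[\Delta]$ is the result of replacing the hole by the hedge $\Delta$. A \emph{sequent} is $\Gamma\Rightarrow A$ with $\Gamma$ a hedge and $A$ a type. It is \emph{provable} in $\mathbf{L}^{*}\Diamond$ if it is derivable from the initial sequents $p_i\Rightarrow p_i$ by the rules (premises before $\vdash$, conclusion after; hedges may be empty): \begin{itemize} \item $\Gamma\Rightarrow A,\ \Delta[B]\Rightarrow C\ \vdash\ \Delta[\Gamma\; A\backslash B]\Rightarrow C$; $\qquad A\,\Pi\Rightarrow B\ \vdash\ \Pi\Rightarrow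 A\backslash B$; \item $\Gamma\Rightarrow A,\ \Delta[B]\Rightarrow C\ \vdash\ \Delta[B/A\;\Gamma]\Rightarrow C$; $\qquad \Pi\,A\Rightarrow B\ \vdash\ \Pi\Rightarrow B/A$; \item $\Gamma[A\,B]\Rightarrow C\ \vdash\ \Gamma[A\bullet B]\Rightarrow C$; $\qquad \Gamma\Rightarrow A,\ \Delta\Rightarrow B\ \vdash\ \Gamma\,\Delta\Rightarrow A\bullet B$; \item $\Gamma[\langle A\rangle]\Rightarrow B\ \vdash\ \Gamma[\Diamond A]\Rightarrow B$; $\qquad \Gamma\Rightarrow A\ \vdash\ \langle\Gamma\rangle\Rightarrow\Diamond A$; \item $\Gamma[A]\Rightarrow B\ \vdash\ \Gamma[\langle\Box^{\downarrow}A\rangle]\Rightarrow B$; $\qquad \langle\Gamma\rangle\Rightarrow A\ \vdash\ \Gamma\Rightarrow\Box^{\downarrow}A$; \item (Cut) $\Gamma\Rightarrow A,\ \Delta[A]\Rightarrow B\ \vdash\ \Delta[\Gamma]\Rightarrow B$. \end{itemize} An $\mathbf{L}^{*}\Diamond$ \emph{grammar} is a triple $G=(\Sigma,I,D)$ with $\Sigma$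 a finite alphabet, $I$ a finite set of pairs $(a,A)$ with $a\in\Sigma$ and $A$ a type, and $D$ a type. It generates the string $a_1\cdots a_n\in\Sigma^{*}$ ($n\ge 0$) if there is a provable sequent $\Gamma\Rightarrow D$ such that the yield of $\Gamma$ is $A_1\cdots A_n$ and $(a_i,A_i)\in I$ for $i=1,\dots,n$. A language is \emph{recognized by} $\mathbf{L}^{*}\Diamond$ if it is the set of all strings generated by some $\mathbf{L}^{*}\Diamond$ grammar. -/

import Mathlib

namespace LStarDiamond

/-- Types of the Lambek calculus with brackets, over the primitive types
`prim 0, prim 1, prim 2, …`. -/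
inductive Tp : Type where
  | prim (i : ℕ) : Tp
  /-- `under A B` is `A \ B`. -/
  | under (A B : Tp) : Tp
  /-- `over B A` is `B / A`. -/
  | over (B A : Tp) : Tp
  /-- `prod A B` is `A • B`. -/
  | prod (A B : Tp) : Tp
  /-- `dia A` is `◇ A`. -/
  | dia (A : Tp) : Tp
  /-- `box A` is `□↓ A`. -/
  | box (A : Tp) : Tp

/-- Type hedges: finite, possibly empty, sequences of type trees, where a type tree is either
a single type or a bracketed type hedge `⟨Γ⟩`. The three constructors say that a hedge is empty,
or starts with a tree that is a type, or starts with a tree that is a bracketed hedge. -/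
inductive Hedge : Type where
  /-- The empty hedge. -/
  | nil : Hedge
  /-- `typ A Γ` is the hedge `A Γ`. -/
  | typ (A : Tp) (Γ : Hedge) : Hedge
  /-- `brk Δ Γ` is the hedge `⟨Δ⟩ Γ`. -/
  | brk (Δ Γ : Hedge) : Hedge

namespace Hedge

/-- Concatenation of hedges. -/
def append : Hedge → Hedge → Hedge
  | nil, Θ => Θ
  | typ A Γ, Θ => typ A (append Γ Θ)
  | brk Δ Γ, Θ => brk Δ (append Γ Θ)

instance : Append Hedge := ⟨append⟩

/-- The hedge consisting of the single type `A`. -/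
def single (A : Tp) : Hedge := typ A nil

/-- The hedge consisting of the single tree `⟨Γ⟩`. -/
def bracket (Γ : Hedge) : Hedge := brk Γ nil

/-- The yield of a hedge: the string of types that label its leaves. -/
def yield : Hedge → List Tp
  | nil => []
  | typ A Γ => A :: yield Γ
  | brk Δ Γ => yield Δ ++ yield Γ

end Hedge

/-- Contexts: hedges with exactly one leaf labelled by the hole `■`. Either the hole is one of the
top-level trees, or it lies inside a top-level tree that is a bracketed context. -/
inductive Ctx : Type where
  /-- `hole Θ₁ Θ₂` is the context `Θ₁ ■ Θ₂`. -/
  | hole (Θ₁ Θ₂ : Hedge) : Ctx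
  /-- `brk Θ₁ Γ Θ₂` is the context `Θ₁ ⟨Γ[■]⟩ Θ₂`. -/
  | brk (Θ₁ : Hedge) (Γ : Ctx) (Θ₂ : Hedge) : Ctx

/-- `Γ.fill Δ` is `Γ[Δ]`: the hole of the context `Γ` is replaced by the hedge `Δ`. -/
def Ctx.fill : Ctx → Hedge → Hedge
  | .hole Θ₁ Θ₂, Δ => Θ₁ ++ Δ ++ Θ₂
  | .brk Θ₁ Γ Θ₂, Δ => Θ₁ ++ (Γ.fill Δ).bracket ++ Θ₂

open Hedge in
/-- `Provable Γ C`: the sequent `Γ ⇒ C` is provable in `L*◇`, the Lambek calculus with brackets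
in which antecedents may be empty. -/
inductive Provable : Hedge → Tp → Prop where
  | init (i : ℕ) : Provable (single (.prim i)) (.prim i)
  | underL (Δ : Ctx) (Γ : Hedge) (A B C : Tp) :
      Provable Γ A → Provable (Δ.fill (single B)) C →
      Provable (Δ.fill (Γ ++ single (.under A B))) C
  | underR (Θ : Hedge) (A B : Tp) :
      Provable (single A ++ Θ) B → Provable Θ (.under A B)
  | overL (Δ : Ctx) (Γ : Hedge) (A B C : Tp) :
      Provable Γ A → Provable (Δ.fill (single B)) C →
      Provable (Δ.fill (single (.over B A) ++ Γ)) C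
  | overR (Θ : Hedge) (A B : Tp) :
      Provable (Θ ++ single A) B → Provable Θ (.over B A)
  | prodL (Γ : Ctx) (A B C : Tp) :
      Provable (Γ.fill (single A ++ single B)) C → Provable (Γ.fill (single (.prod A B))) C
  | prodR (Γ Δ : Hedge) (A B : Tp) :
      Provable Γ A → Provable Δ B → Provable (Γ ++ Δ) (.prod A B)
  | diaL (Γ : Ctx) (A B : Tp) :
      Provable (Γ.fill (bracket (single A))) B → Provable (Γ.fill (single (.dia A))) B
  | diaR (Γ : Hedge) (A : Tp) :
      Provable Γ A → Provable (bracket Γ) (.dia A)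
  | boxL (Γ : Ctx) (A B : Tp) :
      Provable (Γ.fill (single A)) B → Provable (Γ.fill (bracket (single (.box A)))) B
  | boxR (Γ : Hedge) (A : Tp) :
      Provable (bracket Γ) A → Provable Γ (.box A)
  | cut (Δ : Ctx) (Γ : Hedge) (A B : Tp) :
      Provable Γ A → Provable (Δ.fill (single A)) B → Provable (Δ.fill Γ) B

/-- An `L*◇` grammar over the alphabet `α`: a finite lexicon that relates letters to types,
and a distinguished type. -/
structure TypeGrammar (α : Type*) where
  lexicon : Set (α × Tp)
  finite_lexicon : lexicon.Finite
  goal : Tp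

/-- The language generated by an `L*◇` grammar: the strings `a₁ … aₙ` (`n ≥ 0`) for which some
provable sequent `Γ ⇒ D`, with `D` the distinguished type, has yield `A₁ … Aₙ` with every
`(aᵢ, Aᵢ)` in the lexicon. -/
def TypeGrammar.language {α : Type*} (G : TypeGrammar α) : Language α :=
  {w | ∃ Γ : Hedge, Provable Γ G.goal ∧
    List.Forall₂ (fun a A => (a, A) ∈ G.lexicon) w Γ.yield}

/-- A language is recognized by `L*◇` if some `L*◇` grammar generates it. -/
def Recognized {α : Type*} (L : Language α) : Prop :=
  ∃ G : TypeGrammar α, G.language = L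

end LStarDiamond

/-!
The nontrivial point is that finitely many sequents, with at most two types in the antecedent and
with types of bounded length, generate by means of cut all provable sequents `Γ ⇒ C` whose types are
subtypes of the types of the type grammar. These sequents, read from right to left, are the rules of
the context-free grammar, in which types are the nonterminals (`ruleSet`). Soundness of this grammar
is an application of the cut rule (`exists_provable_of_derives`).

*Brackets.* By cut elimination, which is proved semantically with sets of hedges closed under the
biorthogonal `polarClosure` (`Tp.sem_spec`, `Provable.cutFree`), a provable sequent has a proof in
which only subtypes occur. In such a proof each bracket of the antecedent is introduced by the right
rule for `◇` or by the left rule for `□↓`. Hence the brackets can be removed one at a time,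
innermost first: the string of types inside a bracket either proves some `A` with `◇ A` a subtype,
and the tree is replaced by `◇ A`, or it proves some subtype `□↓ A`, and the tree is replaced by `A`
(`CutFree.exists_reduces`). What remains is a provable sequent with a bracket-free antecedent.

*Labels.* The occurrences of primitive types and modalities in a cut-free proof can be labelled so
that each labelled letter occurs at most twice in the final sequent, which is then called thin
(`CutFree.exists_thin`). A labelled sequent is written as a string of types and labelled brackets
(`LProvable`), so that a bracket, too, contributes letters.

*Interpolation.* Let `m` be a nonempty balanced segment of the antecedent of a labelled sequent
`l m r ⇒ C`. There is an interpolant: a type `E` such that `m ⇒ E` and `l E r ⇒ C` are provable and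
every letter occurs in `E` at most as often as it does in `m`, and at most as often as it does
outside of `m` (`LProvable.interpolable`). Interpolants of bracketed segments are needed in the
induction. That of the segment `⟨⟩` would be `◇ 1` with a unit `1`, which is not a type; its place is
taken by constants that stand for types `◇ D` with `D` provable from the empty hedge (`LTp.closed`).
If `l m r ⇒ C` is thin, then these bounds make `m ⇒ E` and `l E r ⇒ C` thin as well, and no letter
occurs twice in `E`.

*Short interpolants.* Types are interpreted in the free group over the letters, in such a way that a
provable sequent becomes an equality (`LProvable.value_eq`). An interpolant in which no letter
occurs twice is represented by a reduced word, so its length is the norm of its value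
(`LTp.size_eq_norm`), and its value equals that of the segment. If a product of at least two elements of
a free group is `1`, then some two neighbours have a product whose norm is at most the maximum of
their norms (`FreeGroup.exists_norm_mul_le`, a lemma of Pentus). For a thin sequent
`A₁ … Aₙ ⇒ C` with `n ≥ 3` this is applied to the values of the `Aᵢ`, followed by the inverse of the
value of `C`. If the neighbours are `Aᵢ` and `Aᵢ₊₁`, then this segment has an interpolant that is no
longer than the types of the sequent. If they are `Aₙ` and `C`, then the same holds for the segment
`A₁ … Aₙ₋₁`. In both cases the sequent is the result of a cut of a shorter thin sequent and a sequent
with two types in the antecedent (`LProvable.derives`).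
-/

/-! ### Hedges and contexts -/

namespace LStarDiamond

/-- Structural induction on types. The case of `B / A` is called `quot`, as the name of the
constructor is a reserved token. -/
@[elab_as_elim, induction_eliminator]
theorem Tp.induct {motive : Tp → Prop} (prim : ∀ i, motive (.prim i))
    (under : ∀ A B, motive A → motive B → motive (.under A B))
    (quot : ∀ B A, motive B → motive A → motive (.over B A))
    (prod : ∀ A B, motive A → motive B → motive (.prod A B))
    (dia : ∀ A, motive A → motive (.dia A)) (box : ∀ A, motive A → motive (.box A)) (A : Tp) :
    motive A :=
  Tp.rec prim under quot prod dia box A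

namespace Hedge

@[simp] theorem nil_append' (Γ : Hedge) : Hedge.nil ++ Γ = Γ := rfl
@[simp] theorem typ_append (A : Tp) (Γ Δ : Hedge) : typ A Γ ++ Δ = typ A (Γ ++ Δ) := rfl
@[simp] theorem brk_append (Θ Γ Δ : Hedge) : brk Θ Γ ++ Δ = brk Θ (Γ ++ Δ) := rfl

@[simp] theorem append_nil' (Γ : Hedge) : Γ ++ Hedge.nil = Γ := by
  induction Γ with
  | nil => rfl
  | typ A Γ ih => simp [ih]
  | brk Δ Γ _ ih => simp [ih]

@[simp] theorem append_assoc' (Γ Δ Θ : Hedge) : Γ ++ Δ ++ Θ = Γ ++ (Δ ++ Θ) := by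
  induction Γ with
  | nil => rfl
  | typ A Γ ih => simp [ih]
  | brk Δ Γ _ ih => simp [ih]

@[simp] theorem yield_append (Γ Δ : Hedge) : (Γ ++ Δ).yield = Γ.yield ++ Δ.yield := by
  induction Γ with
  | nil => rfl
  | typ A Γ ih => simp [yield, ih]
  | brk Δ Γ _ ih => simp [yield, ih]

@[simp] theorem yield_nil : Hedge.nil.yield = [] := rfl
@[simp] theorem yield_typ (A : Tp) (Γ : Hedge) : (typ A Γ).yield = A :: Γ.yield := rfl
@[simp] theorem yield_brk (Δ Γ : Hedge) : (brk Δ Γ).yield = Δ.yield ++ Γ.yield := rfl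
@[simp] theorem yield_single (A : Tp) : (single A).yield = [A] := rfl
@[simp] theorem yield_bracket (Γ : Hedge) : (bracket Γ).yield = Γ.yield := by
  simp [bracket, yield]

/-- The bracket-free hedge with a given yield. -/
def ofList : List Tp → Hedge
  | [] => nil
  | A :: l => typ A (ofList l)

@[simp] theorem ofList_nil : ofList [] = nil := rfl
@[simp] theorem ofList_cons (A : Tp) (l : List Tp) : ofList (A :: l) = typ A (ofList l) := rfl

@[simp] theorem ofList_append (l m : List Tp) : ofList (l ++ m) = ofList l ++ ofList m := by
  induction l with
  | nil => rfl
  | cons A l ih => simp [ih]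

@[simp] theorem yield_ofList (l : List Tp) : (ofList l).yield = l := by
  induction l with
  | nil => rfl
  | cons A l ih => simp [ih]

end Hedge

open Hedge

/-- The leaves to the left and to the right of the hole are not affected by filling it. -/
theorem Ctx.exists_yield_fill (u : Ctx) :
    ∃ y z : List Tp, ∀ Γ, (u.fill Γ).yield = y ++ Γ.yield ++ z := by
  induction u with
  | hole Θ₁ Θ₂ => exact ⟨Θ₁.yield, Θ₂.yield, fun Γ => by simp [Ctx.fill]⟩
  | brk Θ₁ v Θ₂ ih =>
    obtain ⟨y, z, h⟩ := ih
    exact ⟨Θ₁.yield ++ y, z ++ Θ₂.yield, fun Γ => by simp [Ctx.fill, h]⟩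

theorem Ctx.exists_fill_prepend (u : Ctx) (Γ : Hedge) :
    ∃ v : Ctx, ∀ Θ, v.fill Θ = Γ ++ u.fill Θ := by
  cases u with
  | hole Θ₁ Θ₂ => exact ⟨.hole (Γ ++ Θ₁) Θ₂, fun Θ => by simp [Ctx.fill]⟩
  | brk Θ₁ v Θ₂ => exact ⟨.brk (Γ ++ Θ₁) v Θ₂, fun Θ => by simp [Ctx.fill]⟩

/-- Filling a context after putting trees next to the hole is again filling a context. -/
theorem Ctx.exists_fill_append (u : Ctx) (Γ Δ : Hedge) :
    ∃ v : Ctx, ∀ Θ, v.fill Θ = u.fill (Γ ++ Θ ++ Δ) := by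
  induction u with
  | hole Θ₁ Θ₂ => exact ⟨.hole (Θ₁ ++ Γ) (Δ ++ Θ₂), fun Θ => by simp [Ctx.fill]⟩
  | brk Θ₁ v Θ₂ ih =>
    obtain ⟨v', h⟩ := ih
    exact ⟨.brk Θ₁ v' Θ₂, fun Θ => by simp [Ctx.fill, h]⟩

/-- Filling a context after putting a bracket around the hole is again filling a context. -/
theorem Ctx.exists_fill_bracket (u : Ctx) :
    ∃ v : Ctx, ∀ Θ, v.fill Θ = u.fill (bracket Θ) := by
  induction u with
  | hole Θ₁ Θ₂ => exact ⟨.brk Θ₁ (.hole .nil .nil) Θ₂, fun Θ => by simp [Ctx.fill]⟩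
  | brk Θ₁ v Θ₂ ih =>
    obtain ⟨v', h⟩ := ih
    exact ⟨.brk Θ₁ v' Θ₂, fun Θ => by simp [Ctx.fill, h]⟩

theorem Ctx.exists_fill_fill (u v : Ctx) : ∃ w : Ctx, ∀ Θ, w.fill Θ = u.fill (v.fill Θ) := by
  induction v generalizing u with
  | hole Θ₁ Θ₂ => exact u.exists_fill_append Θ₁ Θ₂
  | brk Θ₁ v Θ₂ ih =>
    obtain ⟨u₁, hu₁⟩ := u.exists_fill_append Θ₁ Θ₂
    obtain ⟨u₂, hu₂⟩ := u₁.exists_fill_bracket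
    obtain ⟨w, hw⟩ := ih u₂
    exact ⟨w, fun Θ => by rw [hw, hu₂, hu₁]; rfl⟩

/-- A leaf of a hedge, singled out in its yield, can be turned into the hole of a context. -/
theorem Hedge.exists_fill_of_yield (Γ : Hedge) :
    ∀ (y z : List Tp) (A : Tp), Γ.yield = y ++ A :: z →
      ∃ u : Ctx, u.fill (single A) = Γ ∧ ∀ Θ, (u.fill Θ).yield = y ++ Θ.yield ++ z := by
  induction Γ with
  | nil => intro y z A h; simp at h
  | typ B Γ ih =>
    intro y z A h
    rcases y with _ | ⟨C, y⟩
    · simp only [yield_typ, List.nil_append, List.cons.injEq] at h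
      obtain ⟨rfl, rfl⟩ := h
      exact ⟨.hole .nil Γ, rfl, fun Θ => by simp [Ctx.fill]⟩
    · simp only [yield_typ, List.cons_append, List.cons.injEq] at h
      obtain ⟨rfl, h⟩ := h
      obtain ⟨u, hu, hy⟩ := ih y z A h
      obtain ⟨v, hv⟩ := u.exists_fill_prepend (single B)
      exact ⟨v, by rw [hv, hu]; rfl, fun Θ => by simp [hv, hy]⟩
  | brk Δ Γ ihΔ ihΓ =>
    intro y z A h
    simp only [yield_brk] at h
    obtain ⟨y', rfl, h'⟩ | ⟨z', h', h''⟩ := List.append_eq_append_iff.1 h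
    · obtain ⟨u, hu, hy⟩ := ihΓ y' z A h'
      obtain ⟨v, hv⟩ := u.exists_fill_prepend (bracket Δ)
      exact ⟨v, by rw [hv, hu]; rfl, fun Θ => by simp [hv, hy]⟩
    · rcases z' with _ | ⟨B, z'⟩
      · simp only [List.nil_append, List.append_nil] at h' h''
        obtain ⟨u, hu, hy⟩ := ihΓ [] z A h''.symm
        obtain ⟨v, hv⟩ := u.exists_fill_prepend (bracket Δ)
        exact ⟨v, by rw [hv, hu]; rfl, fun Θ => by simp [hv, hy, h']⟩
      · simp only [List.cons_append, List.cons.injEq] at h''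
        obtain ⟨rfl, rfl⟩ := h''
        obtain ⟨u, hu, hy⟩ := ihΔ y z' A h'
        exact ⟨.brk .nil u Γ, by simp [Ctx.fill, hu, bracket],
          fun Θ => by simp [Ctx.fill, hy, bracket]⟩

/-! ### Cut elimination -/

/-- Cut-free provability in `L*◇`. -/
inductive CutFree : Hedge → Tp → Prop where
  | init (i : ℕ) : CutFree (single (.prim i)) (.prim i)
  | underL (Δ : Ctx) (Γ : Hedge) (A B C : Tp) :
      CutFree Γ A → CutFree (Δ.fill (single B)) C →
      CutFree (Δ.fill (Γ ++ single (.under A B))) C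
  | underR (Θ : Hedge) (A B : Tp) :
      CutFree (single A ++ Θ) B → CutFree Θ (.under A B)
  | overL (Δ : Ctx) (Γ : Hedge) (A B C : Tp) :
      CutFree Γ A → CutFree (Δ.fill (single B)) C →
      CutFree (Δ.fill (single (.over B A) ++ Γ)) C
  | overR (Θ : Hedge) (A B : Tp) :
      CutFree (Θ ++ single A) B → CutFree Θ (.over B A)
  | prodL (Γ : Ctx) (A B C : Tp) :
      CutFree (Γ.fill (single A ++ single B)) C → CutFree (Γ.fill (single (.prod A B))) C
  | prodR (Γ Δ : Hedge) (A B : Tp) :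
      CutFree Γ A → CutFree Δ B → CutFree (Γ ++ Δ) (.prod A B)
  | diaL (Γ : Ctx) (A B : Tp) :
      CutFree (Γ.fill (bracket (single A))) B → CutFree (Γ.fill (single (.dia A))) B
  | diaR (Γ : Hedge) (A : Tp) :
      CutFree Γ A → CutFree (bracket Γ) (.dia A)
  | boxL (Γ : Ctx) (A B : Tp) :
      CutFree (Γ.fill (single A)) B → CutFree (Γ.fill (bracket (single (.box A)))) B
  | boxR (Γ : Hedge) (A : Tp) :
      CutFree (bracket Γ) A → CutFree Γ (.box A)

theorem CutFree.provable {Γ : Hedge} {C : Tp} (h : CutFree Γ C) : Provable Γ C := by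
  induction h with
  | init i => exact .init i
  | underL Δ Γ A B C _ _ h₁ h₂ => exact .underL Δ Γ A B C h₁ h₂
  | underR Θ A B _ h => exact .underR Θ A B h
  | overL Δ Γ A B C _ _ h₁ h₂ => exact .overL Δ Γ A B C h₁ h₂
  | overR Θ A B _ h => exact .overR Θ A B h
  | prodL Γ A B C _ h => exact .prodL Γ A B C h
  | prodR Γ Δ A B _ _ h₁ h₂ => exact .prodR Γ Δ A B h₁ h₂
  | diaL Γ A B _ h => exact .diaL Γ A B h
  | diaR Γ A _ h => exact .diaR Γ A h
  | boxL Γ A B _ h => exact .boxL Γ A B h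
  | boxR Γ A _ h => exact .boxR Γ A h

/-- The closure operator of the polarity between hedges and pairs of a context and a succedent
that is given by cut-free provability. -/
def polarClosure (S : Set Hedge) : Set Hedge :=
  {Γ | ∀ (u : Ctx) (C : Tp), (∀ Δ ∈ S, CutFree (u.fill Δ) C) → CutFree (u.fill Γ) C}

/-- The interpretation of a type as a closed set of hedges. -/
def Tp.sem : Tp → Set Hedge
  | .prim i => {Γ | CutFree Γ (.prim i)}
  | .under A B => {Γ | ∀ Δ ∈ A.sem, Δ ++ Γ ∈ B.sem}
  | .over B A => {Γ | ∀ Δ ∈ A.sem, Γ ++ Δ ∈ B.sem}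
  | .prod A B => polarClosure {Γ | ∃ Δ ∈ A.sem, ∃ Θ ∈ B.sem, Γ = Δ ++ Θ}
  | .dia A => polarClosure {Γ | ∃ Δ ∈ A.sem, Γ = bracket Δ}
  | .box A => {Γ | bracket Γ ∈ A.sem}

/-- The interpretation of a hedge. -/
def Hedge.sem : Hedge → Set Hedge
  | .nil => {.nil}
  | .typ A Γ => {Δ | ∃ Δ₁ ∈ A.sem, ∃ Δ₂ ∈ Γ.sem, Δ = Δ₁ ++ Δ₂}
  | .brk Θ Γ => {Δ | ∃ Δ₁ ∈ Θ.sem, ∃ Δ₂ ∈ Γ.sem, Δ = bracket Δ₁ ++ Δ₂}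

theorem subset_polarClosure (S : Set Hedge) : S ⊆ polarClosure S :=
  fun Γ hΓ _ _ h => h Γ hΓ

theorem polarClosure_idem (S : Set Hedge) : polarClosure (polarClosure S) ⊆ polarClosure S :=
  fun _ hΓ u C h => hΓ u C fun _ hΔ => hΔ u C h

theorem polarClosure_mono {S T : Set Hedge} (h : S ⊆ T) : polarClosure S ⊆ polarClosure T :=
  fun _ hΓ u C hT => hΓ u C fun Δ hΔ => hT Δ (h hΔ)

theorem append_mem_polarClosure {S : Set Hedge} {Θ₁ Θ₂ Γ : Hedge}
    (h : Γ ∈ polarClosure S) : Θ₁ ++ Γ ++ Θ₂ ∈ polarClosure {Δ | ∃ Θ ∈ S, Δ = Θ₁ ++ Θ ++ Θ₂} := by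
  intro u C hu
  obtain ⟨v, hv⟩ := u.exists_fill_append Θ₁ Θ₂
  rw [← hv]
  exact h v C fun Δ hΔ => by rw [hv]; exact hu _ ⟨Δ, hΔ, rfl⟩

theorem bracket_mem_polarClosure {S : Set Hedge} {Γ : Hedge}
    (h : Γ ∈ polarClosure S) : bracket Γ ∈ polarClosure {Δ | ∃ Θ ∈ S, Δ = bracket Θ} := by
  intro u C hu
  obtain ⟨v, hv⟩ := u.exists_fill_bracket
  rw [← hv]
  exact h v C fun Δ hΔ => by rw [hv]; exact hu _ ⟨Δ, hΔ, rfl⟩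

theorem Tp.sem_closed (A : Tp) : polarClosure A.sem ⊆ A.sem := by
  induction A with
  | prim i =>
    intro Γ hΓ
    have := hΓ (.hole .nil .nil) (.prim i) fun Δ hΔ => by simpa [Ctx.fill, Tp.sem] using hΔ
    simpa [Ctx.fill, Tp.sem] using this
  | under A B _ ihB =>
    intro Γ hΓ Δ hΔ
    apply ihB
    have := append_mem_polarClosure (Θ₁ := Δ) (Θ₂ := .nil) hΓ
    rw [append_nil'] at this
    refine polarClosure_mono ?_ this
    rintro _ ⟨Θ, hΘ, rfl⟩
    simpa using hΘ Δ hΔ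
  | quot B A ihB _ =>
    intro Γ hΓ Δ hΔ
    apply ihB
    have := append_mem_polarClosure (Θ₁ := .nil) (Θ₂ := Δ) hΓ
    refine polarClosure_mono ?_ this
    rintro _ ⟨Θ, hΘ, rfl⟩
    exact hΘ Δ hΔ
  | prod A B _ _ => exact polarClosure_idem _
  | dia A _ => exact polarClosure_idem _
  | box A ih =>
    intro Γ hΓ
    apply ih
    refine polarClosure_mono ?_ (bracket_mem_polarClosure hΓ)
    rintro _ ⟨Θ, hΘ, rfl⟩
    exact hΘ

/-- Okada's lemma: the interpretation of `A` lies between the hedge `A` and the set of hedges from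
which `A` is provable without cut. -/
theorem Tp.sem_spec (A : Tp) : single A ∈ A.sem ∧ ∀ Γ ∈ A.sem, CutFree Γ A := by
  induction A with
  | prim i => exact ⟨.init i, fun _ h => h⟩
  | under A B ihA ihB =>
    refine ⟨fun Δ hΔ => B.sem_closed fun u C hu => ?_, fun Γ hΓ => ?_⟩
    · exact .underL u Δ A B C (ihA.2 _ hΔ) (hu _ ihB.1)
    · exact .underR _ _ _ (ihB.2 _ (hΓ _ ihA.1))
  | quot B A ihB ihA =>
    refine ⟨fun Δ hΔ => B.sem_closed fun u C hu => ?_, fun Γ hΓ => ?_⟩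
    · exact .overL u Δ A B C (ihA.2 _ hΔ) (hu _ ihB.1)
    · exact .overR _ _ _ (ihB.2 _ (hΓ _ ihA.1))
  | prod A B ihA ihB =>
    refine ⟨fun u C hu => .prodL u A B C (hu _ ⟨_, ihA.1, _, ihB.1, rfl⟩), fun Γ hΓ => ?_⟩
    have := hΓ (.hole .nil .nil) (.prod A B) (by
      rintro _ ⟨Δ, hΔ, Θ, hΘ, rfl⟩
      simpa [Ctx.fill] using CutFree.prodR _ _ _ _ (ihA.2 _ hΔ) (ihB.2 _ hΘ))
    simpa [Ctx.fill] using this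
  | dia A ih =>
    refine ⟨fun u C hu => .diaL u A C (hu _ ⟨_, ih.1, rfl⟩), fun Γ hΓ => ?_⟩
    have := hΓ (.hole .nil .nil) (.dia A) (by
      rintro _ ⟨Δ, hΔ, rfl⟩
      simpa [Ctx.fill] using CutFree.diaR _ _ (ih.2 _ hΔ))
    simpa [Ctx.fill] using this
  | box A ih =>
    refine ⟨A.sem_closed fun u C hu => .boxL u A C (hu _ ih.1), fun Γ hΓ => ?_⟩
    exact .boxR _ _ (ih.2 _ hΓ)

theorem Hedge.mem_sem_append {Γ Δ Θ : Hedge} :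
    Θ ∈ (Γ ++ Δ).sem ↔ ∃ Θ₁ ∈ Γ.sem, ∃ Θ₂ ∈ Δ.sem, Θ = Θ₁ ++ Θ₂ := by
  induction Γ generalizing Θ with
  | nil => simp [Hedge.sem]
  | typ A Γ ih =>
    constructor
    · rintro ⟨Δ₁, h₁, Δ₂, h₂, rfl⟩
      obtain ⟨Θ₁, h₃, Θ₂, h₄, rfl⟩ := ih.1 h₂
      exact ⟨Δ₁ ++ Θ₁, ⟨_, h₁, _, h₃, rfl⟩, Θ₂, h₄, by simp⟩
    · rintro ⟨_, ⟨Δ₁, h₁, Δ₂, h₂, rfl⟩, Θ₂, h₃, rfl⟩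
      exact ⟨Δ₁, h₁, _, ih.2 ⟨_, h₂, _, h₃, rfl⟩, by simp⟩
  | brk Ψ Γ _ ih =>
    constructor
    · rintro ⟨Δ₁, h₁, Δ₂, h₂, rfl⟩
      obtain ⟨Θ₁, h₃, Θ₂, h₄, rfl⟩ := ih.1 h₂
      exact ⟨bracket Δ₁ ++ Θ₁, ⟨_, h₁, _, h₃, rfl⟩, Θ₂, h₄, by simp⟩
    · rintro ⟨_, ⟨Δ₁, h₁, Δ₂, h₂, rfl⟩, Θ₂, h₃, rfl⟩
      exact ⟨Δ₁, h₁, _, ih.2 ⟨_, h₂, _, h₃, rfl⟩, by simp⟩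

@[simp] theorem Hedge.mem_sem_single {A : Tp} {Θ : Hedge} : Θ ∈ (single A).sem ↔ Θ ∈ A.sem := by
  simp [Hedge.single, Hedge.sem]

@[simp] theorem Hedge.mem_sem_bracket {Γ Θ : Hedge} :
    Θ ∈ (bracket Γ).sem ↔ ∃ Δ ∈ Γ.sem, Θ = bracket Δ := by
  simp [Hedge.bracket, Hedge.sem]

/-- The interpretation of a filled context consists of fillings of contexts. -/
theorem Hedge.exists_fill_of_mem_sem {u : Ctx} {Γ Θ : Hedge} (h : Θ ∈ (u.fill Γ).sem) :
    ∃ v : Ctx, ∃ Δ ∈ Γ.sem, Θ = v.fill Δ ∧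
      ∀ Γ' : Hedge, ∀ Δ' ∈ Γ'.sem, v.fill Δ' ∈ (u.fill Γ').sem := by
  induction u generalizing Θ with
  | hole Θ₁ Θ₂ =>
    obtain ⟨_, h₀, Δ₂, h₂, rfl⟩ := mem_sem_append.1 h
    obtain ⟨Δ₁, h₁, Δ, h₃, rfl⟩ := mem_sem_append.1 h₀
    exact ⟨.hole Δ₁ Δ₂, Δ, h₃, rfl, fun Γ' Δ' h' =>
      mem_sem_append.2 ⟨_, mem_sem_append.2 ⟨_, h₁, _, h', rfl⟩, _, h₂, rfl⟩⟩
  | brk Θ₁ u Θ₂ ih =>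
    obtain ⟨_, h₀, Δ₂, h₂, rfl⟩ := mem_sem_append.1 h
    obtain ⟨Δ₁, h₁, Δ, h₃, rfl⟩ := mem_sem_append.1 h₀
    obtain ⟨Δ, h₅, rfl⟩ := mem_sem_bracket.1 h₃
    obtain ⟨v, Δ, h₄, rfl, hv⟩ := ih h₅
    exact ⟨.brk Δ₁ v Δ₂, Δ, h₄, rfl, fun Γ' Δ' h' =>
      mem_sem_append.2 ⟨_, mem_sem_append.2 ⟨_, h₁, _,
        mem_sem_bracket.2 ⟨_, hv _ _ h', rfl⟩, rfl⟩, _, h₂, rfl⟩⟩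

/-- Filling a context with an element of the closure of `S` stays in a closed set that contains
the fillings with elements of `S`. -/
theorem fill_mem_sem_of_polarClosure {S : Set Hedge} {C : Tp} {v : Ctx} {Γ : Hedge}
    (hΓ : Γ ∈ polarClosure S) (h : ∀ Δ ∈ S, v.fill Δ ∈ C.sem) : v.fill Γ ∈ C.sem := by
  refine C.sem_closed fun u D hu => ?_
  obtain ⟨w, hw⟩ := u.exists_fill_fill v
  rw [← hw]
  exact hΓ w D fun Δ hΔ => by rw [hw]; exact hu _ (h Δ hΔ)

theorem Provable.sem_subset {Γ : Hedge} {C : Tp} (h : Provable Γ C) : Γ.sem ⊆ C.sem := by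
  induction h with
  | init i => intro Θ h; simpa using h
  | underL u Γ A B C _ _ ih₁ ih₂ =>
    intro Θ h
    obtain ⟨v, Δ, hΔ, rfl, hv⟩ := exists_fill_of_mem_sem h
    obtain ⟨Δ₁, h₁, Δ₂, h₂, rfl⟩ := mem_sem_append.1 hΔ
    exact ih₂ (hv _ _ (mem_sem_single.2 (mem_sem_single.1 h₂ _ (ih₁ h₁))))
  | underR Θ A B _ ih =>
    intro Γ hΓ Δ hΔ
    exact ih (mem_sem_append.2 ⟨_, mem_sem_single.2 hΔ, _, hΓ, rfl⟩)
  | overL u Γ A B C _ _ ih₁ ih₂ =>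
    intro Θ h
    obtain ⟨v, Δ, hΔ, rfl, hv⟩ := exists_fill_of_mem_sem h
    obtain ⟨Δ₁, h₁, Δ₂, h₂, rfl⟩ := mem_sem_append.1 hΔ
    exact ih₂ (hv _ _ (mem_sem_single.2 (mem_sem_single.1 h₁ _ (ih₁ h₂))))
  | overR Θ A B _ ih =>
    intro Γ hΓ Δ hΔ
    exact ih (mem_sem_append.2 ⟨_, hΓ, _, mem_sem_single.2 hΔ, rfl⟩)
  | prodL u A B C _ ih =>
    intro Θ h
    obtain ⟨v, Δ, hΔ, rfl, hv⟩ := exists_fill_of_mem_sem h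
    refine fill_mem_sem_of_polarClosure (mem_sem_single.1 hΔ) ?_
    rintro _ ⟨Δ₁, h₁, Δ₂, h₂, rfl⟩
    exact ih (hv _ _ (mem_sem_append.2 ⟨_, mem_sem_single.2 h₁, _, mem_sem_single.2 h₂, rfl⟩))
  | prodR Γ Δ A B _ _ ih₁ ih₂ =>
    intro Θ h
    obtain ⟨Δ₁, h₁, Δ₂, h₂, rfl⟩ := mem_sem_append.1 h
    exact subset_polarClosure _ ⟨_, ih₁ h₁, _, ih₂ h₂, rfl⟩
  | diaL u A B _ ih =>
    intro Θ h
    obtain ⟨v, Δ, hΔ, rfl, hv⟩ := exists_fill_of_mem_sem h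
    refine fill_mem_sem_of_polarClosure (mem_sem_single.1 hΔ) ?_
    rintro _ ⟨Δ₁, h₁, rfl⟩
    exact ih (hv _ _ (mem_sem_bracket.2 ⟨_, mem_sem_single.2 h₁, rfl⟩))
  | diaR Γ A _ ih =>
    intro Θ h
    obtain ⟨Δ, h₁, rfl⟩ := mem_sem_bracket.1 h
    exact subset_polarClosure _ ⟨_, ih h₁, rfl⟩
  | boxL u A B _ ih =>
    intro Θ h
    obtain ⟨v, Δ, hΔ, rfl, hv⟩ := exists_fill_of_mem_sem h
    obtain ⟨Δ, h₁, rfl⟩ := mem_sem_bracket.1 hΔ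
    have h₂ : Δ ∈ (Tp.box A).sem := mem_sem_single.1 h₁
    exact ih (hv _ _ ((mem_sem_single (A := A) (Θ := bracket Δ)).2 h₂))
  | boxR Γ A _ ih =>
    intro Θ h
    exact ih (mem_sem_bracket.2 ⟨_, h, rfl⟩)
  | cut u Γ A B _ _ ih₁ ih₂ =>
    intro Θ h
    obtain ⟨v, Δ, hΔ, rfl, hv⟩ := exists_fill_of_mem_sem h
    exact ih₂ (hv _ _ (mem_sem_single.2 (ih₁ hΔ)))

theorem Hedge.self_mem_sem (Γ : Hedge) : Γ ∈ Γ.sem := by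
  induction Γ with
  | nil => rfl
  | typ A Γ ih => exact ⟨_, A.sem_spec.1, _, ih, rfl⟩
  | brk Δ Γ ihΔ ihΓ => exact ⟨_, ihΔ, _, ihΓ, rfl⟩

/-- Cut elimination for `L*◇`. -/
theorem Provable.cutFree {Γ : Hedge} {C : Tp} (h : Provable Γ C) : CutFree Γ C :=
  C.sem_spec.2 _ (h.sem_subset Γ.self_mem_sem)

theorem Provable.refl (A : Tp) : Provable (single A) A :=
  (A.sem_spec.2 _ A.sem_spec.1).provable

end LStarDiamond

/-! ### Elimination of brackets -/

namespace LStarDiamond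

open Hedge

/-- A set of types that contains the immediate subtypes of its elements. -/
structure SubClosed (S : Set Tp) : Prop where
  under : ∀ {A B}, Tp.under A B ∈ S → A ∈ S ∧ B ∈ S
  quot : ∀ {A B}, Tp.over B A ∈ S → B ∈ S ∧ A ∈ S
  prod : ∀ {A B}, Tp.prod A B ∈ S → A ∈ S ∧ B ∈ S
  dia : ∀ {A}, Tp.dia A ∈ S → A ∈ S
  box : ∀ {A}, Tp.box A ∈ S → A ∈ S

/-- `Reduces S Γ Θ`: the hedge `Γ` is turned into the string of types `Θ` by replacing, from the
inside out, each tree `⟨Δ⟩`, with `Δ` already a string of types, by `◇ A` if `Δ ⇒ A` is provable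
and `◇ A ∈ S`, or by `A` if `Δ ⇒ □↓ A` is provable and `□↓ A ∈ S`. -/
inductive Reduces (S : Set Tp) : Hedge → List Tp → Prop where
  | nil : Reduces S .nil []
  | typ {A : Tp} {Γ : Hedge} {Θ : List Tp} : Reduces S Γ Θ → Reduces S (.typ A Γ) (A :: Θ)
  | dia {Δ Γ : Hedge} {Λ Θ : List Tp} {A : Tp} : Reduces S Δ Λ → Tp.dia A ∈ S →
      Provable (ofList Λ) A → Reduces S Γ Θ → Reduces S (.brk Δ Γ) (Tp.dia A :: Θ)
  | box {Δ Γ : Hedge} {Λ Θ : List Tp} {A : Tp} : Reduces S Δ Λ → Tp.box A ∈ S →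
      Provable (ofList Λ) (.box A) → Reduces S Γ Θ → Reduces S (.brk Δ Γ) (A :: Θ)

theorem Reduces.append {S : Set Tp} {Γ Δ : Hedge} {Θ Λ : List Tp} (h₁ : Reduces S Γ Θ)
    (h₂ : Reduces S Δ Λ) : Reduces S (Γ ++ Δ) (Θ ++ Λ) := by
  induction h₁ with
  | nil => exact h₂
  | typ _ ih => exact .typ ih
  | dia h hA hp _ _ ih => exact .dia h hA hp ih
  | box h hA hp _ _ ih => exact .box h hA hp ih

theorem Reduces.exists_of_append {S : Set Tp} {Γ Δ : Hedge} {Θ : List Tp}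
    (h : Reduces S (Γ ++ Δ) Θ) :
    ∃ Θ₁ Θ₂, Θ = Θ₁ ++ Θ₂ ∧ Reduces S Γ Θ₁ ∧ Reduces S Δ Θ₂ := by
  induction Γ generalizing Θ with
  | nil => exact ⟨[], Θ, rfl, .nil, h⟩
  | typ A Γ ih =>
    obtain _ | h := h
    obtain ⟨Θ₁, Θ₂, rfl, h₁, h₂⟩ := ih h
    exact ⟨A :: Θ₁, Θ₂, rfl, .typ h₁, h₂⟩
  | brk Ψ Γ _ ih =>
    obtain _ | _ | ⟨h, hA, hp, h'⟩ | ⟨h, hA, hp, h'⟩ := h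
    · obtain ⟨Θ₁, Θ₂, rfl, h₁, h₂⟩ := ih h'
      exact ⟨_ :: Θ₁, Θ₂, rfl, .dia h hA hp h₁, h₂⟩
    · obtain ⟨Θ₁, Θ₂, rfl, h₁, h₂⟩ := ih h'
      exact ⟨_ :: Θ₁, Θ₂, rfl, .box h hA hp h₁, h₂⟩

theorem Reduces.single {S : Set Tp} {A : Tp} : Reduces S (single A) [A] := .typ .nil

theorem Reduces.eq_of_single {S : Set Tp} {A : Tp} {Θ : List Tp}
    (h : Reduces S (Hedge.single A) Θ) : Θ = [A] := by
  obtain _ | ⟨⟨⟩⟩ := h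
  rfl

/-- `Stronger Θ Λ`: the string `Θ` can replace `Λ` in every bracket-free provable sequent. -/
def Stronger (Θ Λ : List Tp) : Prop :=
  ∀ (l r : List Tp) (C : Tp), Provable (ofList (l ++ Λ ++ r)) C → Provable (ofList (l ++ Θ ++ r)) C

theorem Stronger.refl (Θ : List Tp) : Stronger Θ Θ := fun _ _ _ h => h

theorem Stronger.append_left {Θ Λ : List Tp} (h : Stronger Θ Λ) (Ξ : List Tp) :
    Stronger (Ξ ++ Θ) (Ξ ++ Λ) := fun l r C hC => by
  simpa using h (l ++ Ξ) r C (by simpa using hC)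

theorem Stronger.append_right {Θ Λ : List Tp} (h : Stronger Θ Λ) (Ξ : List Tp) :
    Stronger (Θ ++ Ξ) (Λ ++ Ξ) := fun l r C hC => by
  simpa using h l (Ξ ++ r) C (by simpa using hC)

theorem Stronger.provable {Θ Λ : List Tp} (h : Stronger Θ Λ) {C : Tp}
    (hC : Provable (ofList Λ) C) : Provable (ofList Θ) C := by
  simpa using h [] [] C (by simpa using hC)

theorem Stronger.of_provable {Θ : List Tp} {A : Tp} (h : Provable (ofList Θ) A) :
    Stronger Θ [A] := fun l r C hC => by
  have := Provable.cut (.hole (ofList l) (ofList r)) _ A C h (by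
    simpa [Ctx.fill, Hedge.single] using hC)
  simpa [Ctx.fill] using this

theorem Reduces.mem {S : Set Tp} (hS : SubClosed S) {Γ : Hedge} {Θ : List Tp}
    (h : Reduces S Γ Θ) (hΓ : ∀ A ∈ Γ.yield, A ∈ S) : ∀ A ∈ Θ, A ∈ S := by
  induction h with
  | nil => simp
  | typ _ ih =>
    simp only [yield_typ, List.mem_cons, forall_eq_or_imp] at hΓ ⊢
    exact ⟨hΓ.1, ih hΓ.2⟩
  | dia _ hA _ _ _ ih =>
    simp only [yield_brk, List.mem_append, List.mem_cons, forall_eq_or_imp] at hΓ ⊢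
    exact ⟨hA, ih fun A hA => hΓ A (.inr hA)⟩
  | box _ hA _ _ _ ih =>
    simp only [yield_brk, List.mem_append, List.mem_cons, forall_eq_or_imp] at hΓ ⊢
    exact ⟨hS.box hA, ih fun A hA => hΓ A (.inr hA)⟩

/-- If every reduct of `Γ` can be replaced by a reduct of `Δ`, then the same is true of `u[Γ]` and
`u[Δ]`. -/
theorem Reduces.exists_fill {S : Set Tp} {Γ Δ : Hedge}
    (hΔ : ∀ Θ, Reduces S Γ Θ → ∃ Λ, Reduces S Δ Λ ∧ Stronger Λ Θ) (u : Ctx) {Θ : List Tp}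
    (h : Reduces S (u.fill Γ) Θ) : ∃ Λ, Reduces S (u.fill Δ) Λ ∧ Stronger Λ Θ := by
  induction u generalizing Θ with
  | hole Θ₁ Θ₂ =>
    obtain ⟨_, Λ₂, rfl, h, h₂⟩ := h.exists_of_append
    obtain ⟨Λ₁, Λ, rfl, h₁, h⟩ := h.exists_of_append
    obtain ⟨Ξ, hΞ, hs⟩ := hΔ _ h
    exact ⟨_, (h₁.append hΞ).append h₂, (hs.append_left _).append_right _⟩
  | brk Θ₁ u Θ₂ ih =>
    obtain ⟨_, Λ₂, rfl, h₀, h₂⟩ := h.exists_of_append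
    obtain ⟨Λ₁, Λ, rfl, h₁, h₃⟩ := h₀.exists_of_append
    obtain _ | _ | ⟨h₄, hA, hp, h'⟩ | ⟨h₄, hA, hp, h'⟩ := h₃
    · obtain ⟨Ξ, hΞ, hs⟩ := ih h₄
      exact ⟨_, (h₁.append (.dia hΞ hA (hs.provable hp) h')).append h₂, .refl _⟩
    · obtain ⟨Ξ, hΞ, hs⟩ := ih h₄
      exact ⟨_, (h₁.append (.box hΞ hA (hs.provable hp) h')).append h₂, .refl _⟩

theorem Provable.dia_mono {A B : Tp} (h : Provable (single A) B) :
    Provable (single (.dia A)) (.dia B) :=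
  .diaL (.hole .nil .nil) A _ (.diaR _ _ h)

theorem Provable.of_box {A B : Tp} (h : Provable (single A) (.box B)) :
    Provable (single (.dia A)) B :=
  .diaL (.hole .nil .nil) A _ (.cut (.brk .nil (.hole .nil .nil) .nil) _ _ _ h
    (.boxL (.hole .nil .nil) B B (.refl B)))

theorem forall_mem_yield_fill {S : Set Tp} {u : Ctx} {Γ Δ : Hedge}
    (h : ∀ A ∈ (u.fill Γ).yield, A ∈ S) (hΔ : ∀ A ∈ Δ.yield, A ∈ S) :
    ∀ A ∈ (u.fill Δ).yield, A ∈ S := by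
  obtain ⟨y, z, hu⟩ := u.exists_yield_fill
  simp only [hu, List.mem_append] at h ⊢
  rintro A ((hA | hA) | hA)
  exacts [h A (.inl (.inl hA)), hΔ A hA, h A (.inr hA)]

theorem mem_of_mem_yield_fill {S : Set Tp} {u : Ctx} {Γ : Hedge}
    (h : ∀ A ∈ (u.fill Γ).yield, A ∈ S) : ∀ A ∈ Γ.yield, A ∈ S := by
  obtain ⟨y, z, hu⟩ := u.exists_yield_fill
  simp only [hu, List.mem_append] at h
  exact fun A hA => h A (.inl (.inr hA))

/-- Jäger's observation: in a cut-free proof each bracket is eliminated against a subtype `◇ A` or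
`□↓ A` of the end-sequent. Hence brackets can be removed from a provable sequent by means of
provable bracket-free sequents that contain only subtypes. -/
theorem CutFree.exists_reduces {S : Set Tp} (hS : SubClosed S) {Γ : Hedge} {C : Tp}
    (h : CutFree Γ C) (hΓ : ∀ A ∈ Γ.yield, A ∈ S) (hC : C ∈ S) :
    ∃ Θ, Reduces S Γ Θ ∧ Provable (ofList Θ) C := by
  induction h with
  | init i => exact ⟨_, .single, .init i⟩
  | underL u Γ A B C _ _ ih₁ ih₂ =>
    have hm := mem_of_mem_yield_fill hΓ
    simp only [yield_append, yield_single, List.mem_append, List.mem_singleton] at hm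
    have hAB := hS.under (hm _ (.inr rfl))
    obtain ⟨Λ, hΛ, hA⟩ := ih₁ (fun A hA => hm A (.inl hA)) hAB.1
    obtain ⟨Θ, hΘ, hC⟩ := ih₂ (forall_mem_yield_fill hΓ (by simpa using hAB.2)) hC
    obtain ⟨Ξ, hΞ, hs⟩ := Reduces.exists_fill (Δ := Γ ++ single (.under A B)) (fun Θ hΘ => by
      obtain rfl := hΘ.eq_of_single
      refine ⟨_, hΛ.append .single, .of_provable ?_⟩
      simpa [Ctx.fill, Hedge.single] using
        Provable.underL (.hole .nil .nil) _ A B B hA (.refl B)) u hΘ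
    exact ⟨Ξ, hΞ, hs.provable hC⟩
  | overL u Γ A B C _ _ ih₁ ih₂ =>
    have hm := mem_of_mem_yield_fill hΓ
    simp only [yield_append, yield_single, List.mem_append, List.mem_singleton] at hm
    have hAB := hS.quot (hm _ (.inl rfl))
    obtain ⟨Λ, hΛ, hA⟩ := ih₁ (fun A hA => hm A (.inr hA)) hAB.2
    obtain ⟨Θ, hΘ, hC⟩ := ih₂ (forall_mem_yield_fill hΓ (by simpa using hAB.1)) hC
    obtain ⟨Ξ, hΞ, hs⟩ := Reduces.exists_fill (Δ := single (.over B A) ++ Γ) (fun Θ hΘ => by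
      obtain rfl := hΘ.eq_of_single
      refine ⟨_, Reduces.single.append hΛ, .of_provable ?_⟩
      simpa [Ctx.fill, Hedge.single] using
        Provable.overL (.hole .nil .nil) _ A B B hA (.refl B)) u hΘ
    exact ⟨Ξ, hΞ, hs.provable hC⟩
  | underR Γ A B _ ih =>
    obtain ⟨Θ, hΘ, hB⟩ := ih (by simpa using ⟨(hS.under hC).1, hΓ⟩) (hS.under hC).2
    obtain ⟨Θ₁, Θ₂, rfl, h₁, h₂⟩ := hΘ.exists_of_append
    obtain rfl := h₁.eq_of_single
    exact ⟨Θ₂, h₂, .underR _ _ _ (by simpa [Hedge.single] using hB)⟩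
  | overR Γ A B _ ih =>
    obtain ⟨Θ, hΘ, hB⟩ := ih (by
      simp only [yield_append, yield_single, List.mem_append, List.mem_singleton]
      rintro D (hD | rfl)
      exacts [hΓ D hD, (hS.quot hC).2]) (hS.quot hC).1
    obtain ⟨Θ₁, Θ₂, rfl, h₁, h₂⟩ := hΘ.exists_of_append
    obtain rfl := h₂.eq_of_single
    exact ⟨Θ₁, h₁, .overR _ _ _ (by simpa [Hedge.single] using hB)⟩
  | prodL u A B C _ ih =>
    have hAB := hS.prod (mem_of_mem_yield_fill hΓ (.prod A B) (by simp))
    obtain ⟨Θ, hΘ, hC⟩ := ih (forall_mem_yield_fill hΓ (by simpa using hAB)) hC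
    obtain ⟨Ξ, hΞ, hs⟩ := Reduces.exists_fill (Δ := single (.prod A B)) (fun Θ hΘ => by
      obtain ⟨Θ₁, Θ₂, rfl, h₁, h₂⟩ := hΘ.exists_of_append
      obtain rfl := h₁.eq_of_single
      obtain rfl := h₂.eq_of_single
      refine ⟨_, .single, fun l r D hD => ?_⟩
      have := Provable.prodL (.hole (ofList l) (ofList r)) A B D (by
        simpa [Ctx.fill, Hedge.single] using hD)
      simpa [Ctx.fill, Hedge.single] using this) u hΘ
    exact ⟨Ξ, hΞ, hs.provable hC⟩
  | prodR Γ Δ A B _ _ ih₁ ih₂ =>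
    simp only [yield_append, List.mem_append] at hΓ
    obtain ⟨Θ, hΘ, hA⟩ := ih₁ (fun A hA => hΓ A (.inl hA)) (hS.prod hC).1
    obtain ⟨Λ, hΛ, hB⟩ := ih₂ (fun A hA => hΓ A (.inr hA)) (hS.prod hC).2
    exact ⟨_, hΘ.append hΛ, by simpa using Provable.prodR _ _ _ _ hA hB⟩
  | diaL u A C _ ih =>
    have hA := hS.dia (mem_of_mem_yield_fill hΓ (.dia A) (by simp))
    obtain ⟨Θ, hΘ, hC⟩ := ih (forall_mem_yield_fill hΓ (by simpa using hA)) hC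
    obtain ⟨Ξ, hΞ, hs⟩ := Reduces.exists_fill (Δ := single (.dia A)) (fun Θ hΘ => by
      obtain _ | _ | ⟨h, hA, hp, ⟨⟩⟩ | ⟨h, hA, hp, ⟨⟩⟩ := hΘ
      · obtain rfl := h.eq_of_single
        exact ⟨_, .single, .of_provable (Provable.dia_mono hp)⟩
      · obtain rfl := h.eq_of_single
        exact ⟨_, .single, .of_provable (Provable.of_box hp)⟩) u hΘ
    exact ⟨Ξ, hΞ, hs.provable hC⟩
  | diaR Γ A _ ih =>
    obtain ⟨Θ, hΘ, hA⟩ := ih (by simpa using hΓ) (hS.dia hC)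
    exact ⟨_, .dia hΘ hC hA .nil, .refl _⟩
  | boxL u A C _ ih =>
    have hA := mem_of_mem_yield_fill hΓ (.box A) (by simp)
    obtain ⟨Θ, hΘ, hC⟩ := ih (forall_mem_yield_fill hΓ (by simpa using hS.box hA)) hC
    obtain ⟨Ξ, hΞ, hs⟩ := Reduces.exists_fill (Δ := bracket (single (.box A))) (fun Θ hΘ => by
      obtain rfl := hΘ.eq_of_single
      exact ⟨_, .box .single hA (.refl _) .nil, .refl _⟩) u hΘ
    exact ⟨Ξ, hΞ, hs.provable hC⟩
  | boxR Γ A _ ih =>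
    obtain ⟨Θ, hΘ, hA⟩ := ih (by simpa using hΓ) (hS.box hC)
    obtain _ | _ | ⟨h, hB, hp, ⟨⟩⟩ | ⟨h, hB, hp, ⟨⟩⟩ := hΘ
    · exact ⟨_, h, .boxR _ _ (.cut (.hole .nil .nil) _ _ _ (.diaR _ _ hp) hA)⟩
    · have := Provable.cut (.hole .nil .nil) _ _ _
        (.cut (.brk .nil (.hole .nil .nil) .nil) _ _ _ hp
          (.boxL (.hole .nil .nil) _ _ (.refl _))) hA
      exact ⟨_, h, .boxR _ _ (by simpa [Ctx.fill] using this)⟩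

end LStarDiamond

/-! ### Cancellation in free groups -/

namespace FreeGroup

variable {X : Type*}

theorem isReduced_of_nodup {L : List (X × Bool)} (h : (L.map Prod.fst).Nodup) : IsReduced L := by
  have h' : L.Pairwise fun a b => a.1 ≠ b.1 := by simpa [List.Nodup, List.pairwise_map] using h
  exact (h'.imp fun {a b} hab h => absurd h hab).isChain

variable [DecidableEq X]

theorem norm_mk_of_isReduced {L : List (X × Bool)} (h : IsReduced L) : (mk L).norm = L.length := by
  rw [norm, toWord_mk, h.reduce_eq]

/-- Cancelling in a product of two reduced words removes a suffix of the first word and the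
inverse of this suffix from the front of the second word. -/
theorem exists_cancel (L : List (X × Bool)) : ∀ M, IsReduced L → IsReduced M →
    ∃ a c b, L = a ++ c ∧ M = invRev c ++ b ∧ IsReduced (a ++ b) := by
  induction L using List.reverseRecOn with
  | nil => exact fun M _ hM => ⟨[], [], M, rfl, rfl, hM⟩
  | append_singleton L z ih =>
    intro M hL hM
    rcases M with _ | ⟨y, M⟩
    · exact ⟨L ++ [z], [], [], by simp, rfl, by simpa using hL⟩
    · by_cases hzy : z.1 = y.1 → z.2 = y.2
      · refine ⟨L ++ [z], [], y :: M, by simp, rfl, ?_⟩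
        have : IsReduced ([z] ++ y :: M) := by
          simpa using isReduced_cons_cons.2 ⟨hzy, hM⟩
        simpa using IsReduced.append_overlap hL this (by simp)
      · obtain ⟨a, c, b, rfl, rfl, hab⟩ := ih M (hL.infix ⟨[], [z], by simp⟩)
          (hM.infix ⟨[y], [], by simp⟩)
        refine ⟨a, c ++ [z], b, by simp, ?_, hab⟩
        push Not at hzy
        have : y = (z.1, !z.2) := by
          refine Prod.ext hzy.1.symm ?_
          have := hzy.2
          revert this
          cases z.2 <;> cases y.2 <;> simp
        simp [this, invRev]

theorem exists_toWord_mul (x y : FreeGroup X) : ∃ a c b, x.toWord = a ++ c ∧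
    y.toWord = invRev c ++ b ∧ (x * y).toWord = a ++ b := by
  obtain ⟨a, c, b, hx, hy, hab⟩ := exists_cancel x.toWord y.toWord isReduced_toWord isReduced_toWord
  refine ⟨a, c, b, hx, hy, ?_⟩
  have : x * y = mk (a ++ b) := by
    rw [← mk_toWord (x := x), ← mk_toWord (x := y), hx, hy, ← mul_mk, ← mul_mk, ← mul_mk, ← inv_mk]
    group
  rw [this, toWord_mk, hab.reduce_eq]

/-- If, in a sequence of nontrivial elements of a free group, the product of any two neighbours is
longer than both, then less than half of each word is cancelled from either side in the product of
the sequence, so that more than half of the first word is left. -/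
theorem exists_toWord_prod (l : List (FreeGroup X)) : ∀ x, (∀ y ∈ x :: l, y ≠ 1) →
    (x :: l).IsChain (fun a b => max a.norm b.norm < (a * b).norm) →
    ∃ s t t', x.toWord = s ++ t ∧ (x * l.prod).toWord = s ++ t' ∧ t.length < s.length := by
  induction l with
  | nil =>
    intro x hx _
    refine ⟨x.toWord, [], [], by simp, by simp, ?_⟩
    have := mt norm_eq_zero.1 (hx x (by simp))
    simpa [norm, Nat.pos_iff_ne_zero] using this
  | cons y l ih =>
    intro x hx hc
    rw [List.isChain_cons_cons] at hc
    obtain ⟨s, t, t', hy, hp, hst⟩ := ih y (fun z hz => hx z (by simp [hz])) hc.2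
    obtain ⟨a, c, b, hxa, hyc, hxy⟩ := exists_toWord_mul x y
    have hn := hc.1
    simp only [norm, hxy, hxa, hyc, List.length_append, invRev_length, max_lt_iff] at hn
    have hlen := congrArg List.length hy
    rw [hyc] at hlen hy
    simp only [List.length_append, invRev_length] at hlen
    -- The part `c` cancelled between `x` and `y` is shorter than the part `s` of `y` that survives.
    obtain ⟨s', rfl, rfl⟩ : ∃ s', s = invRev c ++ s' ∧ b = s' ++ t := by
      obtain ⟨s', h₁, h₂⟩ | ⟨s', h₁, h₂⟩ := List.append_eq_append_iff.1 hy
      · exact ⟨s', h₁, h₂⟩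
      · have := congrArg List.length h₁
        simp only [List.length_append, invRev_length] at this
        omega
    have hs' : s' ≠ [] := by
      rintro rfl
      simp at hst hn
      omega
    refine ⟨a, c, s' ++ t', hxa, ?_, by omega⟩
    have h₁ : IsReduced (a ++ s') :=
      (hxy ▸ isReduced_toWord (x := x * y)).infix ⟨[], t, by simp⟩
    have h₂ : IsReduced (s' ++ t') :=
      (hp ▸ isReduced_toWord (x := y * l.prod)).infix ⟨invRev c, [], by simp⟩
    have h₃ := IsReduced.append_overlap h₁ h₂ hs'
    have : x * (y :: l).prod = mk (a ++ s' ++ t') := by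
      rw [List.prod_cons, ← mk_toWord (x := x), ← mk_toWord (x := y * l.prod), hxa, hp]
      simp only [← mul_mk, ← inv_mk]
      group
    rw [this, toWord_mk, h₃.reduce_eq, List.append_assoc]

/-- Pentus's lemma: if the product of at least two elements of a free group is trivial, then two
neighbours have a product that is not longer than both of them. -/
theorem exists_norm_mul_le (l : List (FreeGroup X)) (hl : 2 ≤ l.length) (hp : l.prod = 1) :
    ∃ p x y q, l = p ++ x :: y :: q ∧ (x * y).norm ≤ max x.norm y.norm := by
  by_contra hcon
  push Not at hcon
  have hc : l.IsChain (fun a b => max a.norm b.norm < (a * b).norm) := by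
    rw [List.isChain_iff_forall_rel_of_append_cons_cons]
    intro a b p q h
    exact hcon p a b q h
  have h1 : ∀ y ∈ l, y ≠ 1 := by
    rintro y hy rfl
    obtain ⟨p, q, rfl⟩ := List.append_of_mem hy
    rcases q with _ | ⟨z, q⟩
    · rcases p.eq_nil_or_concat with rfl | ⟨p, z, rfl⟩
      · simp at hl
      · have := hcon p z 1 [] (by simp)
        simp at this
    · have := hcon p 1 z q rfl
      simp at this
  rcases l with _ | ⟨x, l⟩
  · simp at hl
  · obtain ⟨s, t, t', _, h, hs⟩ := exists_toWord_prod l x h1 hc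
    rw [← List.prod_cons, hp, toWord_one] at h
    have := congrArg List.length h
    simp at this
    omega

end FreeGroup

/-! ### Labelled types and token strings -/

namespace LStarDiamond

/-- Letters of the free group in which labelled types are interpreted: the occurrences of primitive
types, and the opening and closing brackets. The labels distinguish occurrences; they are strings,
so that the letters of two sequents can be kept apart by prefixes. -/
inductive Letter : Type where
  | atom (i : ℕ) (a : List Bool) : Letter
  | opn (a : List Bool) : Letter
  | cls (a : List Bool) : Letter
deriving DecidableEq

/-- Types in which primitive types and modalities carry labels. The constant `closed a b D` stands
for `◇ D` where `D` is provable from the empty hedge. It serves as the interpolant of an empty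
bracket, for which the multiplicative unit would be needed otherwise. -/
inductive LTp : Type where
  | prim (i : ℕ) (a : List Bool) : LTp
  | under (A B : LTp) : LTp
  | quot (B A : LTp) : LTp
  | prod (A B : LTp) : LTp
  | dia (a b : List Bool) (A : LTp) : LTp
  | box (a b : List Bool) (A : LTp) : LTp
  | closed (a b : List Bool) (D : Tp) : LTp

namespace LTp

/-- The type that is left when the labels are removed. -/
def erase : LTp → Tp
  | prim i _ => .prim i
  | under A B => .under A.erase B.erase
  | quot B A => .over B.erase A.erase
  | prod A B => .prod A.erase B.erase
  | dia _ _ A => .dia A.erase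
  | box _ _ A => .box A.erase
  | closed _ _ D => .dia D

/-- The primitive types and the types `D` in constants `closed a b D` come from the set `S`. -/
def Over (S : Set Tp) : LTp → Prop
  | prim i _ => .prim i ∈ S
  | under A B => A.Over S ∧ B.Over S
  | quot B A => B.Over S ∧ A.Over S
  | prod A B => A.Over S ∧ B.Over S
  | dia _ _ A => A.Over S
  | box _ _ A => A.Over S
  | closed _ _ D => D ∈ S

open FreeGroup in
/-- The word in the letters and their inverses that represents a type in the free group. -/
def word : LTp → List (Letter × Bool)
  | prim i a => [(.atom i a, true)]
  | under A B => invRev A.word ++ B.word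
  | quot B A => B.word ++ invRev A.word
  | prod A B => A.word ++ B.word
  | dia a b A => (.opn a, true) :: A.word ++ [(.cls b, true)]
  | box a b A => (.opn a, false) :: A.word ++ [(.cls b, false)]
  | closed a b _ => [(.opn a, true), (.cls b, true)]

/-- The interpretation of a type in the free group over the letters. -/
def value (A : LTp) : FreeGroup Letter := .mk A.word

/-- The length of a type: primitive types count once, modalities twice. -/
def size (A : LTp) : ℕ := A.word.length

end LTp

/-- `indic x y` is `1` if `x = y` and `0` otherwise. -/
def indic (x y : Letter) : ℕ := if x = y then 1 else 0

/-- The number of occurrences of a letter in a type. -/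
def LTp.cnt (x : Letter) : LTp → ℕ
  | prim i a => indic x (.atom i a)
  | under A B => A.cnt x + B.cnt x
  | quot B A => B.cnt x + A.cnt x
  | prod A B => A.cnt x + B.cnt x
  | dia a b A => indic x (.opn a) + A.cnt x + indic x (.cls b)
  | box a b A => indic x (.opn a) + A.cnt x + indic x (.cls b)
  | closed a b _ => indic x (.opn a) + indic x (.cls b)

/-- Tokens of a hedge written as a string: types and labelled brackets. -/
inductive Tok (α : Type) : Type where
  | ty (A : α) : Tok α
  | op (a : List Bool) : Tok α
  | cl (a : List Bool) : Tok α

namespace Tok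

variable {α : Type}

/-- The number of brackets opened by a token. -/
def height : Tok α → ℤ
  | ty _ => 0
  | op _ => 1
  | cl _ => -1

/-- The number of occurrences of a letter in a token. -/
def cnt (x : Letter) : Tok LTp → ℕ
  | ty A => A.cnt x
  | op a => indic x (.opn a)
  | cl a => indic x (.cls a)

/-- The interpretation of a token in the free group. -/
def value : Tok LTp → FreeGroup Letter
  | ty A => A.value
  | op a => .of (.opn a)
  | cl a => .of (.cls a)

/-- Removal of labels. -/
def erase : Tok LTp → Tok Tp
  | ty A => ty A.erase
  | op _ => op []
  | cl _ => cl []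

end Tok

open Tok

variable {α : Type}

/-- The number of brackets that are opened and not closed in a string of tokens. -/
def height (l : List (Tok α)) : ℤ := (l.map Tok.height).sum

@[simp] theorem height_nil : height ([] : List (Tok α)) = 0 := rfl
@[simp] theorem height_ty (A : α) (l : List (Tok α)) : height (ty A :: l) = height l := by
  simp [height, Tok.height]
@[simp] theorem height_op (a : List Bool) (l : List (Tok α)) :
    height (op a :: l) = 1 + height l := by
  simp [height, Tok.height]
@[simp] theorem height_cl (a : List Bool) (l : List (Tok α)) :
    height (cl a :: l) = -1 + height l := by
  simp [height, Tok.height]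
@[simp] theorem height_append (l m : List (Tok α)) : height (l ++ m) = height l + height m := by
  simp [height]

/-- The brackets in a string of tokens match each other, labels being disregarded. -/
def Balanced (l : List (Tok α)) : Prop :=
  height l = 0 ∧ ∀ p s, l = p ++ s → 0 ≤ height p

theorem Balanced.suffix {l p s : List (Tok α)} (h : Balanced l) (hl : l = p ++ s) :
    height s ≤ 0 := by
  have h₁ := h.2 p s hl
  have h₂ := h.1
  rw [hl, height_append] at h₂
  omega

theorem balanced_nil : Balanced ([] : List (Tok α)) :=
  ⟨rfl, fun p s h => by simp [(List.append_eq_nil_iff.1 h.symm).1]⟩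

theorem balanced_ty (A : α) : Balanced [ty A] := by
  refine ⟨by simp, fun p s h => ?_⟩
  rcases p with _ | ⟨b, p⟩
  · simp
  · simp only [List.cons_append, List.cons.injEq] at h
    simp [← h.1, (List.append_eq_nil_iff.1 h.2.symm).1]

theorem Balanced.append {l m : List (Tok α)} (hl : Balanced l) (hm : Balanced m) :
    Balanced (l ++ m) := by
  refine ⟨by simp [hl.1, hm.1], fun p s h => ?_⟩
  obtain ⟨q, rfl, h'⟩ | ⟨q, rfl, -⟩ := List.append_eq_append_iff.1 h
  · simpa [hl.1] using hm.2 _ _ h'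
  · exact hl.2 _ _ rfl

theorem Balanced.bracket {l : List (Tok α)} (hl : Balanced l) (a b : List Bool) :
    Balanced (op a :: l ++ [cl b]) := by
  refine ⟨by simp [hl.1], fun p s h => ?_⟩
  rcases p with _ | ⟨c, p⟩
  · simp
  · simp only [List.cons_append, List.cons.injEq] at h
    obtain ⟨rfl, h⟩ := h
    obtain ⟨q, rfl, h'⟩ | ⟨q, rfl, -⟩ := List.append_eq_append_iff.1 h
    · rcases q with _ | ⟨d, q⟩
      · simp [hl.1]
      · simp only [List.cons_append, List.cons.injEq] at h'
        simp [hl.1, ← h'.1, (List.append_eq_nil_iff.1 h'.2.symm).1]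
    · have := hl.2 _ _ rfl
      simp only [height_op]
      omega

/-- If two overlapping strings are balanced, then so are their overlap and the two remainders. -/
theorem Balanced.of_overlap {u v w : List (Tok α)} (h₁ : Balanced (u ++ v))
    (h₂ : Balanced (v ++ w)) : Balanced u ∧ Balanced v ∧ Balanced w := by
  have hu := h₁.2 u v rfl
  have hv := h₂.2 v w rfl
  have e₁ := h₁.1
  have e₂ := h₂.1
  rw [height_append] at e₁ e₂
  refine ⟨⟨by omega, fun p s h => h₁.2 p (s ++ v) (by simp [h])⟩,
    ⟨by omega, fun p s h => h₂.2 p (s ++ w) (by simp [h])⟩, ⟨by omega, fun p s h => ?_⟩⟩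
  have := h₂.2 (v ++ p) s (by simp [h])
  rw [height_append] at this
  omega

/-- A balanced substring can be replaced by another balanced string. -/
theorem Balanced.replace {l m m' r : List (Tok α)} (h : Balanced (l ++ m ++ r)) (hm : Balanced m)
    (hm' : Balanced m') : Balanced (l ++ m' ++ r) := by
  have h₁ := h.1
  simp only [height_append, hm.1] at h₁
  refine ⟨by simp [hm'.1]; omega, fun p s hp => ?_⟩
  obtain ⟨q, rfl, h'⟩ | ⟨q, hq, -⟩ := List.append_eq_append_iff.1 hp
  · have := h.2 (l ++ m ++ q) s (by simp [h'])
    simpa [hm.1, hm'.1] using this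
  · obtain ⟨q', rfl, h'⟩ | ⟨q', rfl, h'⟩ := List.append_eq_append_iff.1 hq
    · have h₂ := h.2 l (m ++ r) (by simp)
      have h₃ := hm'.2 q' q h'
      rw [height_append]
      omega
    · exact h.2 p (q' ++ m ++ r) (by simp)

/-- The number of occurrences of a letter in a string of tokens. -/
def cnt (x : Letter) (l : List (Tok LTp)) : ℕ := (l.map (Tok.cnt x)).sum

@[simp] theorem cnt_nil (x : Letter) : cnt x [] = 0 := rfl
@[simp] theorem cnt_ty (x : Letter) (A : LTp) (l : List (Tok LTp)) :
    cnt x (ty A :: l) = A.cnt x + cnt x l := by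
  simp [cnt, Tok.cnt]
@[simp] theorem cnt_op (x : Letter) (a : List Bool) (l : List (Tok LTp)) :
    cnt x (op a :: l) = indic x (.opn a) + cnt x l := by
  simp [cnt, Tok.cnt]
@[simp] theorem cnt_cl (x : Letter) (a : List Bool) (l : List (Tok LTp)) :
    cnt x (cl a :: l) = indic x (.cls a) + cnt x l := by
  simp [cnt, Tok.cnt]
@[simp] theorem cnt_append (x : Letter) (l m : List (Tok LTp)) :
    cnt x (l ++ m) = cnt x l + cnt x m := by
  simp [cnt]

/-- Cut-free provability for strings of tokens and labelled types. An empty bracket can be turned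
into a type by means of a constant `closed a b D` only, whence the condition in `diaR`. The condition
in `boxR` says that the two brackets that are removed match each other. -/
inductive LProvable (S : Set Tp) : List (Tok LTp) → LTp → Prop where
  | init (i : ℕ) (a : List Bool) : .prim i ∈ S → LProvable S [ty (.prim i a)] (.prim i a)
  | closedInit (a b : List Bool) (D : Tp) : D ∈ S →
      LProvable S [ty (.closed a b D)] (.closed a b D)
  | closedR (a b : List Bool) (D : Tp) : D ∈ S → Provable .nil D →
      LProvable S [op a, cl b] (.closed a b D)
  | underL (l r Γ : List (Tok LTp)) (A B C : LTp) :
      LProvable S Γ A → LProvable S (l ++ ty B :: r) C →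
      LProvable S (l ++ Γ ++ ty (.under A B) :: r) C
  | underR (Γ : List (Tok LTp)) (A B : LTp) :
      LProvable S (ty A :: Γ) B → LProvable S Γ (.under A B)
  | overL (l r Γ : List (Tok LTp)) (A B C : LTp) :
      LProvable S Γ A → LProvable S (l ++ ty B :: r) C →
      LProvable S (l ++ ty (.quot B A) :: (Γ ++ r)) C
  | overR (Γ : List (Tok LTp)) (A B : LTp) :
      LProvable S (Γ ++ [ty A]) B → LProvable S Γ (.quot B A)
  | prodL (l r : List (Tok LTp)) (A B C : LTp) :
      LProvable S (l ++ ty A :: ty B :: r) C → LProvable S (l ++ ty (.prod A B) :: r) C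
  | prodR (Γ Δ : List (Tok LTp)) (A B : LTp) :
      LProvable S Γ A → LProvable S Δ B → LProvable S (Γ ++ Δ) (.prod A B)
  | diaL (l r : List (Tok LTp)) (a b : List Bool) (A B : LTp) :
      LProvable S (l ++ op a :: ty A :: cl b :: r) B → LProvable S (l ++ ty (.dia a b A) :: r) B
  | diaR (Γ : List (Tok LTp)) (a b : List Bool) (A : LTp) : Γ ≠ [] →
      LProvable S Γ A → LProvable S (op a :: (Γ ++ [cl b])) (.dia a b A)
  | boxL (l r : List (Tok LTp)) (a b : List Bool) (A B : LTp) :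
      LProvable S (l ++ ty A :: r) B → LProvable S (l ++ op a :: ty (.box a b A) :: cl b :: r) B
  | boxR (Γ : List (Tok LTp)) (a b : List Bool) (A : LTp) : Balanced Γ →
      LProvable S (op a :: (Γ ++ [cl b])) A → LProvable S Γ (.box a b A)

namespace LProvable

variable {S : Set Tp}

theorem balanced {Γ : List (Tok LTp)} {C : LTp} (h : LProvable S Γ C) : Balanced Γ := by
  have key : ∀ (m m' : List (Tok LTp)), Balanced m → Balanced m' → ∀ l r,
      Balanced (l ++ (m ++ r)) → Balanced (l ++ (m' ++ r)) := fun m m' hm hm' l r hl => by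
    simpa using Balanced.replace (by simpa using hl) hm hm'
  induction h with
  | init i a _ => exact balanced_ty _
  | closedInit a b D _ => exact balanced_ty _
  | closedR a b D _ _ => exact balanced_nil.bracket a b
  | underL l r Γ A B C _ _ ih₁ ih₂ =>
    simpa using key _ (Γ ++ [ty _]) (balanced_ty B) (ih₁.append (balanced_ty _)) l r ih₂
  | underR Γ A B _ ih =>
    exact (Balanced.of_overlap (u := []) (v := [ty A]) (balanced_ty A) ih).2.2
  | overL l r Γ A B C _ _ ih₁ ih₂ =>
    simpa using key _ ([ty _] ++ Γ) (balanced_ty B) ((balanced_ty _).append ih₁) l r ih₂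
  | overR Γ A B _ ih =>
    exact (Balanced.of_overlap (v := [ty A]) (w := []) ih (by simpa using balanced_ty A)).1
  | prodL l r A B C _ ih =>
    exact key [ty A, ty B] [ty _] ((balanced_ty A).append (balanced_ty B)) (balanced_ty _) l r ih
  | prodR Γ Δ A B _ _ ih₁ ih₂ => exact ih₁.append ih₂
  | diaL l r a b A B _ ih =>
    exact key [op a, ty A, cl b] [ty _] ((balanced_ty A).bracket a b) (balanced_ty _) l r ih
  | diaR Γ a b A _ _ ih => exact ih.bracket a b
  | boxL l r a b A B _ ih =>
    exact key [ty A] [op a, ty _, cl b] (balanced_ty _) ((balanced_ty _).bracket a b) l r ih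
  | boxR Γ a b A h _ _ => exact h

end LProvable

/-! ### Interpretation in the free group -/

namespace LTp

open FreeGroup

@[simp] theorem value_under (A B : LTp) : (under A B).value = A.value⁻¹ * B.value := by
  simp [value, word]
@[simp] theorem value_quot (A B : LTp) : (quot B A).value = B.value * A.value⁻¹ := by
  simp [value, word]
@[simp] theorem value_prod (A B : LTp) : (prod A B).value = A.value * B.value := by
  simp [value, word]
@[simp] theorem value_dia (a b : List Bool) (A : LTp) :
    (dia a b A).value = of (.opn a) * A.value * of (.cls b) := by
  simp [value, word, of]
@[simp] theorem value_box (a b : List Bool) (A : LTp) :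
    (box a b A).value = (of (.opn a))⁻¹ * A.value * (of (.cls b))⁻¹ := by
  simp [value, word, of, invRev]
@[simp] theorem value_closed (a b : List Bool) (D : Tp) :
    (closed a b D).value = of (.opn a) * of (.cls b) := by
  simp [value, word, of]

theorem count_word (x : Letter) (A : LTp) : (A.word.map Prod.fst).count x = A.cnt x := by
  have h1 (L : List (Letter × Bool)) :
      ((invRev L).map Prod.fst).count x = (L.map Prod.fst).count x := by
    simp [invRev, Function.comp_def]
  have h2 (y : Letter) : List.count x [y] = indic x y := by
    by_cases hxy : x = y
    · simp [indic, hxy]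
    · simp [indic, hxy, Ne.symm hxy]
  have h3 (y : Letter) (L : List Letter) : (y :: L).count x = indic x y + L.count x := by
    rw [← h2, ← List.singleton_append, List.count_append]
  induction A with
  | prim i a => simp [word, cnt, h2]
  | under A B ihA ihB => simp [word, cnt, h1, ihA, ihB]
  | quot B A ihB ihA => simp [word, cnt, h1, ihA, ihB]
  | prod A B ihA ihB => simp [word, cnt, ihA, ihB]
  | dia a b A ih => simp [word, cnt, h2, h3, ih]; omega
  | box a b A ih => simp [word, cnt, h2, h3, ih]; omega
  | closed a b D => simp [word, cnt, h2, h3]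

theorem norm_value_le (A : LTp) : A.value.norm ≤ A.size := norm_mk_le

/-- If no letter occurs twice in a type, then nothing cancels in its word. -/
theorem size_eq_norm {A : LTp} (h : ∀ x, A.cnt x ≤ 1) : A.size = A.value.norm := by
  refine (norm_mk_of_isReduced (isReduced_of_nodup ?_)).symm
  exact List.nodup_iff_count_le_one.2 fun x => by rw [count_word]; exact h x

end LTp

/-- The interpretation of a string of tokens in the free group. -/
def value (l : List (Tok LTp)) : FreeGroup Letter := (l.map Tok.value).prod

@[simp] theorem value_nil : value [] = 1 := rfl
@[simp] theorem value_ty (A : LTp) (l : List (Tok LTp)) :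
    value (ty A :: l) = A.value * value l := by
  simp [value, Tok.value]
@[simp] theorem value_op (a : List Bool) (l : List (Tok LTp)) :
    value (op a :: l) = .of (.opn a) * value l := by
  simp [value, Tok.value]
@[simp] theorem value_cl (a : List Bool) (l : List (Tok LTp)) :
    value (cl a :: l) = .of (.cls a) * value l := by
  simp [value, Tok.value]
@[simp] theorem value_append (l m : List (Tok LTp)) : value (l ++ m) = value l * value m := by
  simp [value]

theorem LProvable.value_eq {S : Set Tp} {Γ : List (Tok LTp)} {C : LTp} (h : LProvable S Γ C) :
    value Γ = C.value := by
  induction h with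
  | init i a _ => simp
  | closedInit a b D _ => simp
  | closedR a b D _ _ => simp
  | underL l r Γ A B C _ _ ih₁ ih₂ => simpa [ih₁, mul_assoc] using ih₂
  | underR Γ A B _ ih => simp [← ih]
  | overL l r Γ A B C _ _ ih₁ ih₂ => simpa [ih₁, mul_assoc] using ih₂
  | overR Γ A B _ ih => simp [← ih]
  | prodL l r A B C _ ih => simpa [mul_assoc] using ih
  | prodR Γ Δ A B _ _ ih₁ ih₂ => simp [ih₁, ih₂]
  | diaL l r a b A B _ ih => simpa [mul_assoc] using ih
  | diaR Γ a b A _ _ ih => simp [ih, mul_assoc]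
  | boxL l r a b A B _ ih => simpa [mul_assoc] using ih
  | boxR Γ a b A _ _ ih => simp [← ih, mul_assoc]

end LStarDiamond

/-! ### Interpolation -/

namespace LStarDiamond

open Tok

namespace LProvable

variable {S : Set Tp}

theorem refl {A : LTp} (h : A.Over S) : LProvable S [ty A] A := by
  induction A with
  | prim i a => exact .init i a h
  | under A B ihA ihB =>
    exact .underR _ _ _ (by simpa using underL [] [] _ _ _ _ (ihA h.1) (ihB h.2))
  | quot B A ihB ihA =>
    exact .overR _ _ _ (by simpa using overL [] [] _ _ _ _ (ihA h.2) (ihB h.1))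
  | prod A B ihA ihB =>
    exact prodL [] [] _ _ _ (prodR [ty A] [ty B] _ _ (ihA h.1) (ihB h.2))
  | dia a b A ih => exact diaL [] [] _ _ _ _ (diaR _ _ _ _ (by simp) (ih h))
  | box a b A ih => exact boxR _ _ _ _ (balanced_ty _) (boxL [] [] _ _ _ _ (ih h))
  | closed a b D => exact .closedInit a b D h

end LProvable

/-- An interpolant for the part `Δ` of a sequent `l Δ r ⇒ C`: each letter occurs in it at most as
often as in `Δ` and at most as often as in the rest of the sequent. -/
def HasInterpolant (S : Set Tp) (l Δ r : List (Tok LTp)) (C : LTp) : Prop :=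
  ∃ E : LTp, E.Over S ∧ LProvable S Δ E ∧ LProvable S (l ++ ty E :: r) C ∧
    ∀ x, E.cnt x ≤ cnt x Δ ∧ E.cnt x ≤ cnt x l + cnt x r + C.cnt x

/-- The position of one entry of a list relative to a segment of the list. -/
theorem append_cons_eq_append_append {β : Type*} {l₀ r₀ l m r : List β} {t : β}
    (h : l₀ ++ t :: r₀ = l ++ m ++ r) :
    (∃ s, l₀ = l ++ m ++ s ∧ r = s ++ t :: r₀) ∨
    (∃ d₁ d₂, m = d₁ ++ t :: d₂ ∧ l₀ = l ++ d₁ ∧ r₀ = d₂ ++ r) ∨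
    (∃ s, r₀ = s ++ m ++ r ∧ l = l₀ ++ t :: s) := by
  obtain ⟨a, h₁, h₂⟩ | ⟨a, h₁, h₂⟩ := List.append_eq_append_iff.1 h
  · rcases a with _ | ⟨b, a⟩
    · exact .inl ⟨[], by simpa using h₁.symm, h₂.symm⟩
    · simp only [List.cons_append, List.cons.injEq] at h₂
      obtain ⟨rfl, rfl⟩ := h₂
      obtain ⟨c, h₃, h₄⟩ | ⟨c, h₃, h₄⟩ := List.append_eq_append_iff.1 h₁
      · exact .inr (.inl ⟨c, a, h₄, h₃, rfl⟩)
      · rcases c with _ | ⟨d, c⟩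
        · exact .inr (.inl ⟨[], a, by simpa using h₄.symm, by simpa using h₃.symm, rfl⟩)
        · simp only [List.cons_append, List.cons.injEq] at h₄
          obtain ⟨rfl, rfl⟩ := h₄
          exact .inr (.inr ⟨c, by simp, h₃⟩)
  · exact .inl ⟨a, h₁, h₂⟩

namespace HasInterpolant

variable {S : Set Tp}

/-- Transfer of an interpolant along a rule with one premise that leaves the segment alone. -/
theorem of_rest {l l' Δ r r' : List (Tok LTp)} {C C' : LTp} (h : HasInterpolant S l Δ r C)
    (hr : ∀ E, LProvable S (l ++ ty E :: r) C → LProvable S (l' ++ ty E :: r') C')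
    (hc : ∀ x, cnt x l + cnt x r + C.cnt x ≤ cnt x l' + cnt x r' + C'.cnt x) :
    HasInterpolant S l' Δ r' C' := by
  obtain ⟨E, hE, h₁, h₂, h₃⟩ := h
  exact ⟨E, hE, h₁, hr E h₂, fun x => ⟨(h₃ x).1, (h₃ x).2.trans (hc x)⟩⟩

/-- Transfer of an interpolant along a left rule that acts inside the segment. -/
theorem of_segment {l Δ Δ' r : List (Tok LTp)} {C : LTp} (h : HasInterpolant S l Δ r C)
    (hr : ∀ E, LProvable S Δ E → LProvable S Δ' E) (hc : ∀ x, cnt x Δ ≤ cnt x Δ') :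
    HasInterpolant S l Δ' r C := by
  obtain ⟨E, hE, h₁, h₂, h₃⟩ := h
  exact ⟨E, hE, hr E h₁, h₂, fun x => ⟨(h₃ x).1.trans (hc x), (h₃ x).2⟩⟩

end HasInterpolant

/-- Segments of the antecedent of a provable sequent have interpolants. -/
def Interpolable (S : Set Tp) (Γ : List (Tok LTp)) (C : LTp) : Prop :=
  ∀ l Δ r, Γ = l ++ Δ ++ r → Balanced Δ → Δ ≠ [] → HasInterpolant S l Δ r C

namespace Interpolable

variable {S : Set Tp}

theorem underL {l₀ r₀ Γ : List (Tok LTp)} {A B C : LTp} (hA : LProvable S Γ A)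
    (hC : LProvable S (l₀ ++ ty B :: r₀) C) (ih₁ : Interpolable S Γ A)
    (ih₂ : Interpolable S (l₀ ++ ty B :: r₀) C) :
    Interpolable S (l₀ ++ Γ ++ ty (.under A B) :: r₀) C := by
  have left : ∀ l Δ s, l₀ = l ++ Δ ++ s → Balanced Δ → Δ ≠ [] →
      HasInterpolant S l Δ (s ++ Γ ++ ty (.under A B) :: r₀) C := by
    rintro l Δ s rfl hΔ hne
    refine (ih₂ l Δ (s ++ ty B :: r₀) (by simp) hΔ hne).of_rest (fun E hE => ?_) fun x => ?_
    · simpa using LProvable.underL (l ++ ty E :: s) r₀ _ _ _ _ hA (by simpa using hE)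
    · simp [LTp.cnt]; omega
  have inside : ∀ g Δ s, Γ = g ++ Δ ++ s → Balanced Δ → Δ ≠ [] →
      HasInterpolant S (l₀ ++ g) Δ (s ++ ty (.under A B) :: r₀) C := by
    rintro g Δ s rfl hΔ hne
    refine (ih₁ g Δ s rfl hΔ hne).of_rest (fun E hE => ?_) fun x => ?_
    · simpa using LProvable.underL l₀ r₀ _ _ _ _ hE hC
    · simp [LTp.cnt]; omega
  have around : ∀ l d₁ d₂ r, l₀ = l ++ d₁ → r₀ = d₂ ++ r →
      Balanced (d₁ ++ Γ ++ ty (.under A B) :: d₂) →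
      HasInterpolant S l (d₁ ++ Γ ++ ty (.under A B) :: d₂) r C := by
    rintro l d₁ d₂ r rfl rfl hΔ
    have hΔ' : Balanced (d₁ ++ ty B :: d₂) := by
      simpa using Balanced.replace (m := Γ ++ [ty (.under A B)]) (by simpa using hΔ)
        (hA.balanced.append (balanced_ty _)) (balanced_ty B)
    refine (ih₂ l _ r (by simp) hΔ' (by simp)).of_segment (fun E hE => ?_) fun x => ?_
    · exact LProvable.underL _ _ _ _ _ _ hA hE
    · simp [LTp.cnt]; omega
  intro l Δ r h hΔ hne
  obtain ⟨s, h₁, rfl⟩ | ⟨d₁, d₂, rfl, h₁, rfl⟩ | ⟨s, rfl, rfl⟩ := append_cons_eq_append_append h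
  · obtain ⟨q, h₂, rfl⟩ | ⟨s', h₂, rfl⟩ := List.append_eq_append_iff.1 h₁
    · obtain ⟨d, rfl, rfl⟩ | ⟨q', rfl, rfl⟩ := List.append_eq_append_iff.1 h₂
      · by_cases hd : d = []
        · subst hd
          simpa using inside [] q s (by simp) (by simpa using hΔ) (by simpa using hne)
        by_cases hq : q = []
        · subst hq
          simpa using left l d [] (by simp) (by simpa using hΔ) hd
        -- The segment consists of an end of `l₀` and a beginning of `Γ`: the interpolants of
        -- these two parts are multiplied.
        obtain ⟨hd', hq', -⟩ := Balanced.of_overlap hΔ hA.balanced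
        obtain ⟨F, hF, hF₁, hF₂, hF₃⟩ := ih₂ l d (ty B :: r₀) (by simp) hd' hd
        obtain ⟨E, hE, hE₁, hE₂, hE₃⟩ := ih₁ [] q s (by simp) hq' hq
        refine ⟨.prod F E, ⟨hF, hE⟩, .prodR _ _ _ _ hF₁ hE₁, ?_, fun x => ?_⟩
        · refine .prodL _ _ _ _ _ ?_
          simpa using LProvable.underL (l ++ [ty F]) r₀ _ _ _ _ hE₂ (by simpa using hF₂)
        · have := hF₃ x
          have := hE₃ x
          simp [LTp.cnt] at *
          omega
      · exact inside q' Δ s rfl hΔ hne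
    · simpa using left l Δ s' h₂ hΔ hne
  · obtain ⟨g, rfl, rfl⟩ | ⟨d, rfl, rfl⟩ := List.append_eq_append_iff.1 h₁
    · by_cases hg : g = []
      · subst hg
        simpa using around l₀ [] d₂ r (by simp) rfl (by simpa using hΔ)
      -- The segment consists of an end of `Γ`, of `A \ B`, and of a beginning of `r₀`.
      obtain ⟨hg', hd', hd₂⟩ := Balanced.of_overlap hA.balanced hΔ
      have hd₂' : Balanced d₂ := (Balanced.of_overlap (u := []) (v := [ty (A.under B)])
        (balanced_ty _) hd₂).2.2
      obtain ⟨E, hE, hE₁, hE₂, hE₃⟩ := ih₁ [] g d₁ (by simp) hg' hg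
      obtain ⟨F, hF, hF₁, hF₂, hF₃⟩ := ih₂ l₀ (ty B :: d₂) r (by simp)
        ((balanced_ty B).append hd₂') (by simp)
      refine ⟨.under E F, ⟨hE, hF⟩, .underR _ _ _ ?_, ?_, fun x => ?_⟩
      · simpa using LProvable.underL [] d₂ _ _ _ _ hE₂ (by simpa using hF₁)
      · simpa using LProvable.underL l₀ r _ _ _ _ hE₁ hF₂
      · have := hF₃ x
        have := hE₃ x
        simp [LTp.cnt] at *
        omega
    · exact around l d d₂ r rfl rfl hΔ
  · refine (ih₂ (l₀ ++ ty B :: s) Δ r (by simp) hΔ hne).of_rest (fun E hE => ?_) fun x => ?_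
    · simpa using LProvable.underL _ (s ++ ty E :: r) _ _ _ _ hA (by simpa using hE)
    · simp [LTp.cnt]; omega

theorem overL {l₀ r₀ Γ : List (Tok LTp)} {A B C : LTp} (hA : LProvable S Γ A)
    (hC : LProvable S (l₀ ++ ty B :: r₀) C) (ih₁ : Interpolable S Γ A)
    (ih₂ : Interpolable S (l₀ ++ ty B :: r₀) C) :
    Interpolable S (l₀ ++ ty (.quot B A) :: (Γ ++ r₀)) C := by
  have right : ∀ s Δ r, r₀ = s ++ Δ ++ r → Balanced Δ → Δ ≠ [] →
      HasInterpolant S (l₀ ++ ty (.quot B A) :: (Γ ++ s)) Δ r C := by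
    rintro s Δ r rfl hΔ hne
    refine (ih₂ (l₀ ++ ty B :: s) Δ r (by simp) hΔ hne).of_rest (fun E hE => ?_) fun x => ?_
    · simpa using LProvable.overL l₀ (s ++ ty E :: r) _ _ _ _ hA (by simpa using hE)
    · simp [LTp.cnt]; omega
  have inside : ∀ g Δ s, Γ = g ++ Δ ++ s → Balanced Δ → Δ ≠ [] →
      HasInterpolant S (l₀ ++ ty (.quot B A) :: g) Δ (s ++ r₀) C := by
    rintro g Δ s rfl hΔ hne
    refine (ih₁ g Δ s rfl hΔ hne).of_rest (fun E hE => ?_) fun x => ?_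
    · simpa using LProvable.overL l₀ r₀ _ _ _ _ hE hC
    · simp [LTp.cnt]; omega
  have around : ∀ l d₁ d₂ r, l₀ = l ++ d₁ → r₀ = d₂ ++ r →
      Balanced (d₁ ++ ty (.quot B A) :: (Γ ++ d₂)) →
      HasInterpolant S l (d₁ ++ ty (.quot B A) :: (Γ ++ d₂)) r C := by
    rintro l d₁ d₂ r rfl rfl hΔ
    have hΔ' : Balanced (d₁ ++ ty B :: d₂) := by
      simpa using Balanced.replace (m := [ty (.quot B A)] ++ Γ) (by simpa using hΔ)
        ((balanced_ty _).append hA.balanced) (balanced_ty B)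
    refine (ih₂ l _ r (by simp) hΔ' (by simp)).of_segment (fun E hE => ?_) fun x => ?_
    · exact LProvable.overL _ _ _ _ _ _ hA hE
    · simp [LTp.cnt]; omega
  intro l Δ r h hΔ hne
  obtain ⟨s, rfl, rfl⟩ | ⟨d₁, d₂, rfl, rfl, h₁⟩ | ⟨s, h₁, rfl⟩ := append_cons_eq_append_append h
  · refine (ih₂ l Δ (s ++ ty B :: r₀) (by simp) hΔ hne).of_rest (fun E hE => ?_) fun x => ?_
    · simpa using LProvable.overL (l ++ ty E :: s) r₀ _ _ _ _ hA (by simpa using hE)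
    · simp [LTp.cnt]; omega
  · obtain ⟨d, rfl, rfl⟩ | ⟨g, rfl, rfl⟩ := List.append_eq_append_iff.1 h₁
    · exact around l d₁ d r rfl rfl hΔ
    · by_cases hg : g = []
      · subst hg
        simpa using around l d₁ [] r₀ rfl (by simp) (by simpa using hΔ)
      -- The segment consists of an end of `l₀`, of `B / A`, and of a beginning of `Γ`.
      obtain ⟨hd₁, hd₂, hg'⟩ := Balanced.of_overlap (u := d₁ ++ [ty (.quot B A)])
        (by simpa using hΔ) hA.balanced
      have hd₁' : Balanced d₁ := (Balanced.of_overlap (v := [ty (.quot B A)]) (w := [])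
        hd₁ (by simpa using balanced_ty _)).1
      obtain ⟨E, hE, hE₁, hE₂, hE₃⟩ := ih₁ d₂ g [] (by simp) hg' hg
      obtain ⟨F, hF, hF₁, hF₂, hF₃⟩ := ih₂ l (d₁ ++ [ty B]) r₀ (by simp)
        (hd₁'.append (balanced_ty B)) (by simp)
      refine ⟨.quot F E, ⟨hF, hE⟩, .overR _ _ _ ?_, ?_, fun x => ?_⟩
      · simpa using LProvable.overL d₁ [] _ _ _ _ hE₂ (by simpa using hF₁)
      · exact LProvable.overL l r₀ _ _ _ _ hE₁ hF₂
      · have := hF₃ x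
        have := hE₃ x
        simp [LTp.cnt] at *
        omega
  · obtain ⟨q, h₂, rfl⟩ | ⟨q, h₂, rfl⟩ := List.append_eq_append_iff.1 h₁
    · obtain ⟨g, rfl, rfl⟩ | ⟨s', rfl, rfl⟩ := List.append_eq_append_iff.1 h₂
      · by_cases hg : g = []
        · subst hg
          simpa using right [] q r (by simp) (by simpa using hΔ) (by simpa using hne)
        by_cases hq : q = []
        · subst hq
          simpa using inside s g [] (by simp) (by simpa using hΔ) hg
        -- The segment consists of an end of `Γ` and a beginning of `r₀`.
        obtain ⟨-, hg', hq'⟩ := Balanced.of_overlap hA.balanced hΔ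
        obtain ⟨E, hE, hE₁, hE₂, hE₃⟩ := ih₁ s g [] (by simp) hg' hg
        obtain ⟨F, hF, hF₁, hF₂, hF₃⟩ := ih₂ (l₀ ++ [ty B]) q r (by simp) hq' hq
        refine ⟨.prod E F, ⟨hE, hF⟩, .prodR _ _ _ _ hE₁ hF₁, ?_, fun x => ?_⟩
        · refine .prodL _ _ _ _ _ ?_
          simpa using LProvable.overL l₀ (ty F :: r) _ _ _ _ hE₂ (by simpa using hF₂)
        · have := hF₃ x
          have := hE₃ x
          simp [LTp.cnt] at *
          omega
      · exact right s' Δ r rfl hΔ hne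
    · exact inside s Δ q h₂ hΔ hne

/-- Interpolation for a left rule with one premise whose principal part is a single type. -/
theorem replace {l₀ r₀ m : List (Tok LTp)} {A C : LTp} (hm : Balanced m) (hm₀ : m ≠ [])
    (hc : ∀ x, cnt x m = A.cnt x)
    (hr : ∀ l r D, LProvable S (l ++ m ++ r) D → LProvable S (l ++ ty A :: r) D)
    (ih : Interpolable S (l₀ ++ m ++ r₀) C) : Interpolable S (l₀ ++ ty A :: r₀) C := by
  intro l Δ r h hΔ hne
  obtain ⟨s, rfl, rfl⟩ | ⟨d₁, d₂, rfl, rfl, rfl⟩ | ⟨s, rfl, rfl⟩ := append_cons_eq_append_append h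
  · refine (ih l Δ (s ++ m ++ r₀) (by simp) hΔ hne).of_rest (fun E hE => ?_) fun x => ?_
    · simpa using hr (l ++ ty E :: s) r₀ _ (by simpa using hE)
    · simp [hc]
  · have hΔ' : Balanced (d₁ ++ m ++ d₂) :=
      Balanced.replace (m := [ty A]) (by simpa using hΔ) (balanced_ty _) hm
    refine (ih l _ r (by simp) hΔ' (by simp [hm₀])).of_segment (fun E hE => ?_) fun x => ?_
    · exact hr _ _ _ hE
    · simp [hc]
  · refine (ih (l₀ ++ m ++ s) Δ r (by simp) hΔ hne).of_rest (fun E hE => ?_) fun x => ?_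
    · simpa using hr l₀ (s ++ ty E :: r) _ (by simpa using hE)
    · simp [hc]

theorem boxL {l₀ r₀ : List (Tok LTp)} {a b : List Bool} {A C : LTp}
    (ih : Interpolable S (l₀ ++ ty A :: r₀) C) :
    Interpolable S (l₀ ++ op a :: ty (.box a b A) :: cl b :: r₀) C := by
  intro l Δ r h hΔ hne
  obtain ⟨s, h₁, rfl⟩ | ⟨d₁, d₂, rfl, h₁, h₂⟩ | ⟨s, h₁, rfl⟩ :=
    append_cons_eq_append_append (l₀ := l₀ ++ [op a]) (t := ty (.box a b A)) (r₀ := cl b :: r₀)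
      (by simpa using h)
  · rcases s.eq_nil_or_concat with rfl | ⟨s, t, rfl⟩
    · -- A balanced segment does not end with an opening bracket.
      rcases Δ.eq_nil_or_concat with rfl | ⟨Δ, t, rfl⟩
      · exact absurd rfl hne
      · have ht : op a = t := by
          simpa using congrArg List.getLast? h₁
        have := hΔ.suffix (s := [t]) (p := Δ) (by simp)
        simp [← ht] at this
    · have h₃ : l₀ ++ [op a] = (l ++ Δ ++ s) ++ [t] := by simpa using h₁
      obtain ⟨rfl, h₄⟩ := List.append_inj' h₃ rfl
      obtain rfl : op a = t := by simpa using h₄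
      refine (ih l Δ (s ++ ty A :: r₀) (by simp) hΔ hne).of_rest (fun E hE => ?_) fun x => ?_
      · simpa using LProvable.boxL (l ++ ty E :: s) r₀ a b _ _ (by simpa using hE)
      · simp [LTp.cnt]; omega
  · rcases d₁.eq_nil_or_concat with rfl | ⟨d₁, t, rfl⟩
    · rcases d₂ with _ | ⟨t, d₂⟩
      · simp only [List.append_nil, List.nil_append] at h₁ h₂
        subst h₁ h₂
        obtain ⟨E, hE, hE₁, hE₂, hE₃⟩ := ih l₀ [ty A] r₀ (by simp) (balanced_ty A) (by simp)
        refine ⟨.box a b E, hE, .boxR _ _ _ _ (balanced_ty _) (.boxL [] [] _ _ _ _ hE₁), ?_,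
          fun x => ?_⟩
        · simpa using LProvable.boxL l₀ r₀ a b _ _ hE₂
        · have := hE₃ x
          simp [LTp.cnt] at *
          omega
      · simp only [List.cons_append, List.cons.injEq] at h₂
        have := hΔ.2 [ty (.box a b A), cl b] d₂ (by simp [h₂.1])
        simp at this
    · have h₃ : l₀ ++ [op a] = (l ++ d₁) ++ [t] := by simpa using h₁
      obtain ⟨rfl, h₄⟩ := List.append_inj' h₃ rfl
      obtain rfl : op a = t := by simpa using h₄
      rcases d₂ with _ | ⟨t, d₂⟩
      · have := hΔ.suffix (p := d₁) (s := [op a, ty (.box a b A)]) (by simp)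
        simp at this
      · simp only [List.cons_append, List.cons.injEq] at h₂
        obtain ⟨rfl, rfl⟩ := h₂
        have hΔ' : Balanced (d₁ ++ [ty A] ++ d₂) :=
          Balanced.replace (m := [op a, ty (.box a b A), cl b]) (by simpa using hΔ)
            ((balanced_ty _).bracket a b) (balanced_ty _)
        refine (ih l _ r (by simp) hΔ' (by simp)).of_segment (fun E hE => ?_) fun x => ?_
        · simpa using LProvable.boxL d₁ d₂ a b _ _ (by simpa using hE)
        · simp [LTp.cnt]; omega
  · rcases s with _ | ⟨t, s⟩
    · -- A balanced segment does not begin with a closing bracket.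
      rcases Δ with _ | ⟨t, Δ⟩
      · exact absurd rfl hne
      · simp only [List.nil_append, List.cons_append, List.cons.injEq] at h₁
        have := hΔ.2 [t] Δ rfl
        simp [← h₁.1] at this
    · simp only [List.cons_append, List.cons.injEq] at h₁
      obtain ⟨rfl, rfl⟩ := h₁
      refine (ih (l₀ ++ ty A :: s) Δ r (by simp) hΔ hne).of_rest (fun E hE => ?_) fun x => ?_
      · simpa using LProvable.boxL l₀ (s ++ ty E :: r) a b _ _ (by simpa using hE)
      · simp [LTp.cnt]; omega

theorem prodR {Γ Δ : List (Tok LTp)} {A B : LTp} (hA : LProvable S Γ A) (hB : LProvable S Δ B)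
    (ih₁ : Interpolable S Γ A) (ih₂ : Interpolable S Δ B) :
    Interpolable S (Γ ++ Δ) (.prod A B) := by
  have left : ∀ l Θ s, Γ = l ++ Θ ++ s → Balanced Θ → Θ ≠ [] →
      HasInterpolant S l Θ (s ++ Δ) (.prod A B) := by
    rintro l Θ s rfl hΘ hne
    refine (ih₁ l Θ s rfl hΘ hne).of_rest (fun E hE => ?_) fun x => ?_
    · simpa using LProvable.prodR _ _ _ _ hE hB
    · simp [LTp.cnt]; omega
  have right : ∀ s Θ r, Δ = s ++ Θ ++ r → Balanced Θ → Θ ≠ [] →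
      HasInterpolant S (Γ ++ s) Θ r (.prod A B) := by
    rintro s Θ r rfl hΘ hne
    refine (ih₂ s Θ r rfl hΘ hne).of_rest (fun E hE => ?_) fun x => ?_
    · simpa using LProvable.prodR _ _ _ _ hA hE
    · simp [LTp.cnt]; omega
  intro l Θ r h hΘ hne
  obtain ⟨q, h₁, rfl⟩ | ⟨s, rfl, rfl⟩ := List.append_eq_append_iff.1 h
  · obtain ⟨g, rfl, rfl⟩ | ⟨s, rfl, rfl⟩ := List.append_eq_append_iff.1 h₁
    · by_cases hg : g = []
      · subst hg
        simpa using right [] q r (by simp) (by simpa using hΘ) (by simpa using hne)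
      by_cases hq : q = []
      · subst hq
        simpa using left l g [] (by simp) (by simpa using hΘ) hg
      obtain ⟨-, hg', hq'⟩ := Balanced.of_overlap hA.balanced hΘ
      obtain ⟨E, hE, hE₁, hE₂, hE₃⟩ := ih₁ l g [] (by simp) hg' hg
      obtain ⟨F, hF, hF₁, hF₂, hF₃⟩ := ih₂ [] q r (by simp) hq' hq
      refine ⟨.prod E F, ⟨hE, hF⟩, .prodR _ _ _ _ hE₁ hF₁, ?_, fun x => ?_⟩
      · refine .prodL _ _ _ _ _ ?_
        simpa using LProvable.prodR _ _ _ _ hE₂ hF₂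
      · have := hF₃ x
        have := hE₃ x
        simp [LTp.cnt] at *
        omega
    · exact right s Θ r rfl hΘ hne
  · exact left l Θ s rfl hΘ hne

theorem diaR {Γ : List (Tok LTp)} {a b : List Bool} {A : LTp} (hΓ : Γ ≠ []) (hA : LProvable S Γ A)
    (ih : Interpolable S Γ A) : Interpolable S (op a :: (Γ ++ [cl b])) (.dia a b A) := by
  intro l Δ r h hΔ hne
  rcases l with _ | ⟨t, l⟩
  · rcases Δ with _ | ⟨t, Δ⟩
    · exact absurd rfl hne
    simp only [List.nil_append, List.cons_append, List.cons.injEq] at h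
    obtain ⟨rfl, h⟩ := h
    rcases r.eq_nil_or_concat with rfl | ⟨r, t, rfl⟩
    · simp only [List.append_nil] at h
      subst h
      obtain ⟨E, hE, hE₁, hE₂, hE₃⟩ := ih [] Γ [] (by simp) hA.balanced hΓ
      refine ⟨.dia a b E, hE, .diaR _ _ _ _ hΓ hE₁, ?_, fun x => ?_⟩
      · exact .diaL [] [] _ _ _ _ (.diaR _ _ _ _ (by simp) hE₂)
      · have := hE₃ x
        simp [LTp.cnt] at *
        omega
    · have h₁ : Γ ++ [cl b] = (Δ ++ r) ++ [t] := by simpa using h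
      obtain ⟨rfl, -⟩ := List.append_inj' h₁ rfl
      have h₁ := hA.balanced.2 Δ r rfl
      have h₂ := hΔ.1
      simp at h₂
      omega
  · simp only [List.cons_append, List.cons.injEq] at h
    obtain ⟨rfl, h⟩ := h
    rcases r.eq_nil_or_concat with rfl | ⟨r, t, rfl⟩
    · rcases Δ.eq_nil_or_concat with rfl | ⟨Δ, t, rfl⟩
      · exact absurd rfl hne
      have h₁ : Γ ++ [cl b] = (l ++ Δ) ++ [t] := by simpa using h
      obtain ⟨rfl, h₂⟩ := List.append_inj' h₁ rfl
      obtain rfl : cl b = t := by simpa using h₂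
      have h₁ := hA.balanced.suffix (p := l) (s := Δ) rfl
      have h₂ := hΔ.1
      simp at h₂
      omega
    · have h₁ : Γ ++ [cl b] = (l ++ Δ ++ r) ++ [t] := by simpa using h
      obtain ⟨rfl, h₂⟩ := List.append_inj' h₁ rfl
      obtain rfl : cl b = t := by simpa using h₂
      refine (ih l Δ r rfl hΔ hne).of_rest (fun E hE => ?_) fun x => ?_
      · simpa using LProvable.diaR _ a b _ (by simp) hE
      · simp [LTp.cnt]; omega

/-- Interpolation for a sequent whose antecedent has no proper balanced segment. -/
theorem of_irreducible {Γ : List (Tok LTp)} {A : LTp} (hA : A.Over S) (h : LProvable S Γ A)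
    (hc : ∀ x, A.cnt x ≤ cnt x Γ)
    (hΓ : ∀ l Δ r, Γ = l ++ Δ ++ r → Balanced Δ → Δ ≠ [] → l = [] ∧ Δ = Γ ∧ r = []) :
    Interpolable S Γ A := by
  intro l Δ r h' hΔ hne
  obtain ⟨rfl, rfl, rfl⟩ := hΓ l Δ r h' hΔ hne
  exact ⟨A, hA, h, .refl hA, fun x => ⟨hc x, by simp⟩⟩

theorem of_ty {A : LTp} (hA : A.Over S) : Interpolable S [ty A] A := by
  refine of_irreducible hA (.refl hA) (by simp) fun l Δ r h _ hne => ?_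
  have := congrArg List.length h
  have := List.length_pos_of_ne_nil hne
  simp at *
  have hl : l = [] := List.eq_nil_of_length_eq_zero (by omega)
  have hr : r = [] := List.eq_nil_of_length_eq_zero (by omega)
  subst hl hr
  simpa using h.symm

end Interpolable

/-- Interpolation theorem: every nonempty balanced segment of the antecedent of a provable sequent
has an interpolant. -/
theorem LProvable.interpolable {S : Set Tp} {Γ : List (Tok LTp)} {C : LTp}
    (h : LProvable S Γ C) : Interpolable S Γ C := by
  induction h with
  | init i a h => exact .of_ty h
  | closedInit a b D h => exact .of_ty h
  | closedR a b D hD h =>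
    refine .of_irreducible hD (.closedR a b D hD h) (by simp [LTp.cnt]) fun l Δ r h hΔ hne => ?_
    have h₁ := hΔ.1
    rcases l with _ | ⟨t, l⟩
    · rcases Δ with _ | ⟨t, Δ⟩
      · exact absurd rfl hne
      simp only [List.nil_append, List.cons_append, List.cons.injEq] at h
      obtain ⟨rfl, h⟩ := h
      rcases Δ with _ | ⟨t, Δ⟩
      · simp at h₁
      simp only [List.cons_append, List.cons.injEq] at h
      obtain ⟨rfl, h⟩ := h
      simp_all
    · simp only [List.cons_append, List.cons.injEq] at h
      obtain ⟨rfl, h⟩ := h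
      rcases l with _ | ⟨t, l⟩
      · rcases Δ with _ | ⟨t, Δ⟩
        · exact absurd rfl hne
        simp only [List.nil_append, List.cons_append, List.cons.injEq] at h
        obtain ⟨rfl, h⟩ := h
        have := hΔ.2 [cl b] Δ rfl
        simp at this
      · simp_all
  | underL l r Γ A B C h₁ h₂ ih₁ ih₂ => exact .underL h₁ h₂ ih₁ ih₂
  | underR Γ A B _ ih =>
    intro l Δ r h hΔ hne
    refine (ih (ty A :: l) Δ r (by simp [h]) hΔ hne).of_rest (fun E hE => .underR _ _ _ hE) ?_
    intro x
    simp [LTp.cnt]; omega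
  | overL l r Γ A B C h₁ h₂ ih₁ ih₂ => exact .overL h₁ h₂ ih₁ ih₂
  | overR Γ A B _ ih =>
    intro l Δ r h hΔ hne
    refine (ih l Δ (r ++ [ty A]) (by simp [h]) hΔ hne).of_rest
      (fun E hE => .overR _ _ _ (by simpa using hE)) ?_
    intro x
    simp [LTp.cnt]; omega
  | prodL l r A B C _ ih =>
    refine .replace (m := [ty A, ty B]) ((balanced_ty A).append (balanced_ty B)) (by simp)
      (by simp [LTp.cnt]) (fun l r D hD => .prodL _ _ _ _ _ (by simpa using hD)) (by simpa using ih)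
  | prodR Γ Δ A B h₁ h₂ ih₁ ih₂ => exact .prodR h₁ h₂ ih₁ ih₂
  | diaL l r a b A B _ ih =>
    refine .replace (m := [op a, ty A, cl b]) ((balanced_ty A).bracket a b) (by simp)
      (by simp [LTp.cnt, add_assoc]) (fun l r D hD => .diaL _ _ _ _ _ _ (by simpa using hD))
      (by simpa using ih)
  | diaR Γ a b A hΓ h ih => exact .diaR hΓ h ih
  | boxL l r a b A B _ ih => exact .boxL ih
  | boxR Γ a b A hΓ _ ih =>
    intro l Δ r h hΔ hne
    refine (ih (op a :: l) Δ (r ++ [cl b]) (by simp [h]) hΔ hne).of_rest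
      (fun E hE => .boxR _ _ _ _ ?_ (by simpa using hE)) ?_
    · simpa using Balanced.replace (m := Δ) (h ▸ hΓ) hΔ (balanced_ty E)
    · intro x
      simp [LTp.cnt]; omega

end LStarDiamond

/-! ### Hedges as strings of tokens -/

namespace LStarDiamond

open Tok Hedge

/-- A hedge written as a string of tokens. -/
def Hedge.flatten : Hedge → List (Tok Tp)
  | .nil => []
  | .typ A Γ => ty A :: Γ.flatten
  | .brk Δ Γ => op [] :: (Δ.flatten ++ cl [] :: Γ.flatten)

namespace Hedge

@[simp] theorem flatten_nil : Hedge.nil.flatten = [] := rfl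
@[simp] theorem flatten_typ (A : Tp) (Γ : Hedge) : (typ A Γ).flatten = ty A :: Γ.flatten := rfl
@[simp] theorem flatten_brk (Δ Γ : Hedge) :
    (brk Δ Γ).flatten = op [] :: (Δ.flatten ++ cl [] :: Γ.flatten) := rfl
@[simp] theorem flatten_single (A : Tp) : (single A).flatten = [ty A] := rfl
@[simp] theorem flatten_bracket (Γ : Hedge) :
    (bracket Γ).flatten = op [] :: (Γ.flatten ++ [cl []]) := rfl

@[simp] theorem flatten_append (Γ Δ : Hedge) : (Γ ++ Δ).flatten = Γ.flatten ++ Δ.flatten := by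
  induction Γ with
  | nil => rfl
  | typ A Γ ih => simp [ih]
  | brk Ψ Γ _ ih => simp [ih]

@[simp] theorem flatten_ofList (l : List Tp) : (ofList l).flatten = l.map ty := by
  induction l with
  | nil => rfl
  | cons A l ih => simp [ih]

theorem balanced_flatten (Γ : Hedge) : Balanced Γ.flatten := by
  induction Γ with
  | nil => exact balanced_nil
  | typ A Γ ih => exact (balanced_ty A).append ih
  | brk Δ Γ ihΔ ihΓ => simpa using (ihΔ.bracket [] []).append ihΓ

end Hedge

theorem Ctx.exists_flatten_fill (u : Ctx) :
    ∃ l r, ∀ Γ, (u.fill Γ).flatten = l ++ Γ.flatten ++ r := by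
  induction u with
  | hole Θ₁ Θ₂ => exact ⟨Θ₁.flatten, Θ₂.flatten, fun Γ => by simp [Ctx.fill]⟩
  | brk Θ₁ v Θ₂ ih =>
    obtain ⟨l, r, h⟩ := ih
    exact ⟨Θ₁.flatten ++ op [] :: l, r ++ cl [] :: Θ₂.flatten, fun Γ => by simp [Ctx.fill, h]⟩

/-- The part of a string before the closing bracket that matches a given opening one is
determined by the string. -/
theorem Balanced.append_cl_inj {α : Type} {p q s t : List (Tok α)} {a b : List Bool}
    (hp : Balanced p) (hq : Balanced q) (h : p ++ cl a :: s = q ++ cl b :: t) :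
    p = q ∧ s = t := by
  obtain ⟨c, h₁, h₂⟩ | ⟨c, h₁, h₂⟩ := List.append_eq_append_iff.1 h
  · rcases c with _ | ⟨d, c⟩
    · simp_all
    · simp only [List.cons_append, List.cons.injEq] at h₂
      have := hq.2 (p ++ [cl a]) c (by simp [h₁, h₂.1])
      simp [hp.1] at this
  · rcases c with _ | ⟨d, c⟩
    · simp_all
    · simp only [List.cons_append, List.cons.injEq] at h₂
      have := hp.2 (q ++ [cl b]) c (by simp [h₁, h₂.1])
      simp [hq.1] at this

namespace Hedge

theorem flatten_injective : Function.Injective flatten := by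
  intro Γ
  induction Γ with
  | nil => intro Δ h; cases Δ <;> simp_all
  | typ A Γ ih =>
    intro Δ h
    cases Δ with
    | nil => simp at h
    | typ B Δ =>
      simp only [flatten_typ, List.cons.injEq, Tok.ty.injEq] at h
      rw [h.1, ih h.2]
    | brk Ψ Δ => simp at h
  | brk Θ Γ ihΘ ihΓ =>
    intro Δ h
    cases Δ with
    | nil => simp at h
    | typ B Δ => simp at h
    | brk Ψ Δ =>
      simp only [flatten_brk, List.cons.injEq, true_and] at h
      obtain ⟨h₁, h₂⟩ := Θ.balanced_flatten.append_cl_inj Ψ.balanced_flatten h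
      rw [ihΘ h₁, ihΓ h₂]

theorem exists_append_of_flatten {Γ Δ : Hedge} {r : List (Tok Tp)}
    (h : Γ.flatten = Δ.flatten ++ r) : ∃ Θ, Γ = Δ ++ Θ ∧ Θ.flatten = r := by
  induction Δ generalizing Γ with
  | nil => exact ⟨Γ, rfl, h⟩
  | typ A Δ ih =>
    cases Γ with
    | nil => simp at h
    | typ B Γ =>
      simp only [flatten_typ, List.cons_append, List.cons.injEq, Tok.ty.injEq] at h
      obtain ⟨Θ, rfl, h'⟩ := ih h.2
      exact ⟨Θ, by simp [h.1], h'⟩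
    | brk Ψ Γ => simp at h
  | brk Ψ Δ _ ih =>
    cases Γ with
    | nil => simp at h
    | typ B Γ => simp at h
    | brk Φ Γ =>
      simp only [flatten_brk, List.cons_append, List.cons.injEq, true_and,
        List.append_assoc] at h
      obtain ⟨h₁, h₂⟩ := Φ.balanced_flatten.append_cl_inj Ψ.balanced_flatten h
      obtain ⟨Θ, rfl, h'⟩ := ih h₂
      exact ⟨Θ, by simp [flatten_injective h₁], h'⟩

/-- A segment of the string of a hedge that is itself the string of a hedge can be turned into the
hole of a context. -/
theorem exists_fill_of_flatten {Γ Δ : Hedge} {l r : List (Tok Tp)}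
    (h : Γ.flatten = l ++ Δ.flatten ++ r) :
    ∃ u : Ctx, u.fill Δ = Γ ∧ ∀ Θ, (u.fill Θ).flatten = l ++ Θ.flatten ++ r := by
  induction Γ generalizing l r with
  | nil =>
    simp only [flatten_nil, List.nil_eq_append_iff, List.append_eq_nil_iff] at h
    obtain rfl : Δ = .nil := flatten_injective h.1.2
    exact ⟨.hole .nil .nil, rfl, fun Θ => by simp [Ctx.fill, h]⟩
  | typ A Γ ih =>
    rcases l with _ | ⟨t, l⟩
    · obtain ⟨Θ, h₁, rfl⟩ := exists_append_of_flatten h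
      exact ⟨.hole .nil Θ, by simp [Ctx.fill, h₁], fun _ => by simp [Ctx.fill]⟩
    · simp only [flatten_typ, List.cons_append, List.cons.injEq] at h
      obtain ⟨u, hu, hf⟩ := ih h.2
      obtain ⟨v, hv⟩ := u.exists_fill_prepend (single A)
      exact ⟨v, by rw [hv, hu]; rfl, fun Θ => by simp [hv, hf, ← h.1]⟩
  | brk Ψ Γ ihΨ ihΓ =>
    rcases l with _ | ⟨t, l⟩
    · obtain ⟨Θ, h₁, rfl⟩ := exists_append_of_flatten h
      exact ⟨.hole .nil Θ, by simp [Ctx.fill, h₁], fun _ => by simp [Ctx.fill]⟩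
    · simp only [flatten_brk, List.cons_append, List.cons.injEq] at h
      obtain ⟨rfl, h⟩ := h
      obtain ⟨s, h₁, rfl⟩ | ⟨d₁, d₂, h₁, h₂, -⟩ | ⟨s, h₁, rfl⟩ := append_cons_eq_append_append h
      · obtain ⟨u, hu, hf⟩ := ihΨ h₁
        exact ⟨.brk .nil u Γ, by simp [Ctx.fill, hu, bracket],
          fun Θ => by simp [Ctx.fill, hf, bracket]⟩
      · -- The segment would contain the closing bracket without the opening one.
        have := Δ.balanced_flatten.2 (d₁ ++ [cl []]) d₂ (by simp [h₁])
        have := Ψ.balanced_flatten.suffix h₂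
        simp at *
        omega
      · obtain ⟨u, hu, hf⟩ := ihΓ h₁
        obtain ⟨v, hv⟩ := u.exists_fill_prepend (bracket Ψ)
        exact ⟨v, by rw [hv, hu]; rfl, fun Θ => by simp [hv, hf]⟩

end Hedge

/-! ### Removing labels -/

theorem height_map_erase (l : List (Tok LTp)) : height (l.map Tok.erase) = height l := by
  have : Tok.height ∘ Tok.erase = Tok.height := by
    funext t; cases t <;> rfl
  simp [height, this]

theorem Balanced.map_erase {l : List (Tok LTp)} (h : Balanced l) : Balanced (l.map Tok.erase) := by
  refine ⟨by rw [height_map_erase, h.1], fun p s hp => ?_⟩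
  obtain ⟨p', s', rfl, rfl, rfl⟩ := List.map_eq_append_iff.1 hp
  rw [height_map_erase]
  exact h.2 _ _ rfl

@[simp] theorem Tok.erase_ty (A : LTp) : (ty A).erase = ty A.erase := rfl
@[simp] theorem Tok.erase_op (a : List Bool) : (op a : Tok LTp).erase = op [] := rfl
@[simp] theorem Tok.erase_cl (a : List Bool) : (cl a : Tok LTp).erase = cl [] := rfl

/-- Erasing the labels turns provable strings of tokens into provable hedges. -/
theorem LProvable.exists_provable {S : Set Tp} {Γ : List (Tok LTp)} {C : LTp}
    (h : LProvable S Γ C) : ∃ Θ : Hedge, Θ.flatten = Γ.map Tok.erase ∧ Provable Θ C.erase := by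
  induction h with
  | init i a _ => exact ⟨_, flatten_single _, .init i⟩
  | closedInit a b D _ => exact ⟨_, flatten_single _, .refl _⟩
  | closedR a b D _ h => exact ⟨_, flatten_bracket .nil, .diaR _ _ h⟩
  | underL l r Γ A B C _ _ ih₁ ih₂ =>
    obtain ⟨Θ, hΘ, h₁⟩ := ih₁
    obtain ⟨Λ, hΛ, h₂⟩ := ih₂
    obtain ⟨u, rfl, hu⟩ := exists_fill_of_flatten (Γ := Λ) (Δ := single B.erase)
      (l := l.map Tok.erase) (r := r.map Tok.erase) (by simp [hΛ])
    exact ⟨_, by simp [hu, hΘ, LTp.erase], .underL u Θ _ _ _ h₁ h₂⟩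
  | underR Γ A B _ ih =>
    obtain ⟨Θ, hΘ, h⟩ := ih
    obtain ⟨Λ, rfl, hΛ⟩ := exists_append_of_flatten (Δ := single A.erase) (r := Γ.map Tok.erase)
      (by simpa using hΘ)
    exact ⟨Λ, hΛ, .underR _ _ _ h⟩
  | overL l r Γ A B C _ _ ih₁ ih₂ =>
    obtain ⟨Θ, hΘ, h₁⟩ := ih₁
    obtain ⟨Λ, hΛ, h₂⟩ := ih₂
    obtain ⟨u, rfl, hu⟩ := exists_fill_of_flatten (Γ := Λ) (Δ := single B.erase)
      (l := l.map Tok.erase) (r := r.map Tok.erase) (by simp [hΛ])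
    exact ⟨_, by simp [hu, hΘ, LTp.erase], .overL u Θ _ _ _ h₁ h₂⟩
  | overR Γ A B h' ih =>
    obtain ⟨Θ, hΘ, h⟩ := ih
    obtain ⟨u, hu, hf⟩ := exists_fill_of_flatten (Γ := Θ) (Δ := single A.erase)
      (l := Γ.map Tok.erase) (r := []) (by simpa using hΘ)
    obtain rfl : Θ = u.fill .nil ++ single A.erase := flatten_injective (by simp [hf, hΘ])
    exact ⟨_, by simp [hf], .overR _ _ _ h⟩
  | prodL l r A B C _ ih =>
    obtain ⟨Λ, hΛ, h⟩ := ih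
    obtain ⟨u, rfl, hu⟩ := exists_fill_of_flatten (Γ := Λ) (Δ := single A.erase ++ single B.erase)
      (l := l.map Tok.erase) (r := r.map Tok.erase) (by simp [hΛ])
    exact ⟨_, by simp [hu, LTp.erase], .prodL u _ _ _ h⟩
  | prodR Γ Δ A B _ _ ih₁ ih₂ =>
    obtain ⟨Θ, hΘ, h₁⟩ := ih₁
    obtain ⟨Λ, hΛ, h₂⟩ := ih₂
    exact ⟨_, by simp [hΘ, hΛ], .prodR _ _ _ _ h₁ h₂⟩
  | diaL l r a b A C _ ih =>
    obtain ⟨Λ, hΛ, h⟩ := ih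
    obtain ⟨u, rfl, hu⟩ := exists_fill_of_flatten (Γ := Λ) (Δ := bracket (single A.erase))
      (l := l.map Tok.erase) (r := r.map Tok.erase) (by simp [hΛ])
    exact ⟨_, by simp [hu, LTp.erase], .diaL u _ _ h⟩
  | diaR Γ a b A _ _ ih =>
    obtain ⟨Θ, hΘ, h⟩ := ih
    exact ⟨_, by simp [hΘ], .diaR _ _ h⟩
  | boxL l r a b A C _ ih =>
    obtain ⟨Λ, hΛ, h⟩ := ih
    obtain ⟨u, rfl, hu⟩ := exists_fill_of_flatten (Γ := Λ) (Δ := single A.erase)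
      (l := l.map Tok.erase) (r := r.map Tok.erase) (by simp [hΛ])
    exact ⟨_, by simp [hu, LTp.erase], .boxL u _ _ h⟩
  | boxR Γ a b A hb _ ih =>
    obtain ⟨Θ, hΘ, h⟩ := ih
    cases Θ with
    | nil => simp at hΘ
    | typ B Θ => simp at hΘ
    | brk Ψ Θ =>
      simp only [flatten_brk, List.map_cons, List.map_append, Tok.erase_op, Tok.erase_cl,
        List.cons.injEq, true_and, List.map_nil] at hΘ
      obtain ⟨h₁, h₂⟩ := Ψ.balanced_flatten.append_cl_inj hb.map_erase hΘ
      obtain rfl : Θ = .nil := flatten_injective h₂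
      exact ⟨Ψ, h₁, .boxR _ _ h⟩

end LStarDiamond

/-! ### Linear labelling -/

namespace LStarDiamond

open Tok Hedge

/-- Prefixing the label of a letter. -/
def Letter.tag (c : Bool) : Letter → Letter
  | atom i a => atom i (c :: a)
  | opn a => opn (c :: a)
  | cls a => cls (c :: a)

/-- Prefixing all labels in a type. -/
def LTp.tag (c : Bool) : LTp → LTp
  | prim i a => prim i (c :: a)
  | under A B => under (A.tag c) (B.tag c)
  | quot B A => quot (B.tag c) (A.tag c)
  | prod A B => prod (A.tag c) (B.tag c)
  | dia a b A => dia (c :: a) (c :: b) (A.tag c)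
  | box a b A => box (c :: a) (c :: b) (A.tag c)
  | closed a b D => closed (c :: a) (c :: b) D

/-- Prefixing all labels in a token. -/
def Tok.tag (c : Bool) : Tok LTp → Tok LTp
  | ty A => ty (A.tag c)
  | op a => op (c :: a)
  | cl a => cl (c :: a)

@[simp] theorem Tok.tag_ty (c : Bool) (A : LTp) : (ty A).tag c = ty (A.tag c) := rfl
@[simp] theorem Tok.tag_op (c : Bool) (a : List Bool) : (op a).tag c = op (c :: a) := rfl
@[simp] theorem Tok.tag_cl (c : Bool) (a : List Bool) : (cl a).tag c = cl (c :: a) := rfl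

@[simp] theorem LTp.erase_tag (c : Bool) (A : LTp) : (A.tag c).erase = A.erase := by
  induction A <;> simp [tag, erase, *]

@[simp] theorem Tok.erase_tag (c : Bool) (t : Tok LTp) : (t.tag c).erase = t.erase := by
  cases t <;> simp

@[simp] theorem Tok.erase_comp_tag (c : Bool) : Tok.erase ∘ Tok.tag c = Tok.erase :=
  funext (Tok.erase_tag c)

theorem Balanced.map_tag {l : List (Tok LTp)} (h : Balanced l) (c : Bool) :
    Balanced (l.map (Tok.tag c)) := by
  have ht : Tok.height ∘ Tok.tag c = Tok.height := by
    funext t; cases t <;> rfl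
  have hh : ∀ m : List (Tok LTp), height (m.map (Tok.tag c)) = height m := fun m => by
    simp [LStarDiamond.height, ht]
  refine ⟨by rw [hh, h.1], fun p s hp => ?_⟩
  obtain ⟨p', s', rfl, rfl, rfl⟩ := List.map_eq_append_iff.1 hp
  rw [hh]
  exact h.2 _ _ rfl

theorem LProvable.tag {S : Set Tp} {Γ : List (Tok LTp)} {C : LTp} (h : LProvable S Γ C)
    (c : Bool) : LProvable S (Γ.map (Tok.tag c)) (C.tag c) := by
  induction h with
  | init i a h => exact .init i _ h
  | closedInit a b D h => exact .closedInit _ _ D h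
  | closedR a b D h h' => exact .closedR _ _ D h h'
  | underL l r Γ A B C _ _ ih₁ ih₂ =>
    simpa [LTp.tag] using LProvable.underL _ _ _ _ _ _ ih₁ (by simpa using ih₂)
  | underR Γ A B _ ih => exact .underR _ _ _ ih
  | overL l r Γ A B C _ _ ih₁ ih₂ =>
    simpa [LTp.tag] using LProvable.overL _ _ _ _ _ _ ih₁ (by simpa using ih₂)
  | overR Γ A B _ ih => exact .overR _ _ _ (by simpa using ih)
  | prodL l r A B C _ ih => simpa [LTp.tag] using LProvable.prodL _ _ _ _ _ (by simpa using ih)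
  | prodR Γ Δ A B _ _ ih₁ ih₂ => simpa [LTp.tag] using LProvable.prodR _ _ _ _ ih₁ ih₂
  | diaL l r a b A C _ ih => simpa [LTp.tag] using LProvable.diaL _ _ _ _ _ _ (by simpa using ih)
  | diaR Γ a b A hΓ _ ih =>
    simpa [LTp.tag] using LProvable.diaR _ (c :: a) (c :: b) _ (by simpa using hΓ) ih
  | boxL l r a b A C _ ih =>
    simpa [LTp.tag] using LProvable.boxL _ _ (c :: a) (c :: b) _ _ (by simpa using ih)
  | boxR Γ a b A hΓ _ ih => exact .boxR _ _ _ _ (hΓ.map_tag c) (by simpa using ih)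

theorem Letter.cases_tag (x : Letter) :
    (∃ c y, x = Letter.tag c y) ∨ ∀ c y, x ≠ Letter.tag c y := by
  by_cases h : ∃ c y, x = Letter.tag c y
  · exact .inl h
  · exact .inr fun c y hxy => h ⟨c, y, hxy⟩

theorem indic_tag (c d : Bool) (x y : Letter) :
    indic (x.tag c) (y.tag d) = if c = d then indic x y else 0 := by
  cases x <;> cases y <;> by_cases h : c = d <;> simp [indic, Letter.tag, h]

theorem indic_of_ne {x : Letter} (hx : ∀ c y, x ≠ Letter.tag c y) (c : Bool) (y : Letter) :
    indic x (y.tag c) = 0 := by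
  simp [indic, hx c y]

theorem LTp.cnt_tag (c d : Bool) (x : Letter) (A : LTp) :
    (A.tag d).cnt (x.tag c) = if c = d then A.cnt x else 0 := by
  have hA : ∀ i a, indic (x.tag c) (.atom i (d :: a)) = if c = d then indic x (.atom i a) else 0 :=
    fun i a => indic_tag c d x (.atom i a)
  have hO : ∀ a, indic (x.tag c) (.opn (d :: a)) = if c = d then indic x (.opn a) else 0 :=
    fun a => indic_tag c d x (.opn a)
  have hC : ∀ a, indic (x.tag c) (.cls (d :: a)) = if c = d then indic x (.cls a) else 0 :=
    fun a => indic_tag c d x (.cls a)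
  induction A <;> by_cases h : c = d <;> simp_all [tag, cnt]

theorem LTp.cnt_tag_of_ne {x : Letter} (hx : ∀ c y, x ≠ Letter.tag c y) (c : Bool) (A : LTp) :
    (A.tag c).cnt x = 0 := by
  have hA := fun i a => indic_of_ne hx c (.atom i a)
  have hO := fun a => indic_of_ne hx c (.opn a)
  have hC := fun a => indic_of_ne hx c (.cls a)
  simp only [Letter.tag] at hA hO hC
  induction A <;> simp_all [tag, cnt]

theorem cnt_map_tag (c d : Bool) (x : Letter) (l : List (Tok LTp)) :
    cnt (x.tag c) (l.map (Tok.tag d)) = if c = d then cnt x l else 0 := by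
  have hO : ∀ a, indic (x.tag c) (.opn (d :: a)) = if c = d then indic x (.opn a) else 0 :=
    fun a => indic_tag c d x (.opn a)
  have hC : ∀ a, indic (x.tag c) (.cls (d :: a)) = if c = d then indic x (.cls a) else 0 :=
    fun a => indic_tag c d x (.cls a)
  induction l with
  | nil => simp
  | cons t l ih => cases t <;> by_cases h : c = d <;> simp_all [LTp.cnt_tag, Tok.tag]

theorem cnt_map_tag_of_ne {x : Letter} (hx : ∀ c y, x ≠ Letter.tag c y) (c : Bool)
    (l : List (Tok LTp)) : cnt x (l.map (Tok.tag c)) = 0 := by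
  have hO := fun a => indic_of_ne hx c (.opn a)
  have hC := fun a => indic_of_ne hx c (.cls a)
  simp only [Letter.tag] at hO hC
  induction l with
  | nil => simp
  | cons t l ih => cases t <;> simp_all [LTp.cnt_tag_of_ne hx, Tok.tag]

/-- A sequent is thin if no letter occurs more than twice in it. -/
def Thin (Γ : List (Tok LTp)) (C : LTp) : Prop := ∀ x, cnt x Γ + C.cnt x ≤ 2

/-- Two thin sequents with different tags have no letter in common. -/
theorem Thin.tag_add {Γ Δ : List (Tok LTp)} {A B : LTp} (h₁ : Thin Γ A) (h₂ : Thin Δ B)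
    (x : Letter) : cnt x (Γ.map (Tok.tag true)) + (A.tag true).cnt x +
      (cnt x (Δ.map (Tok.tag false)) + (B.tag false).cnt x) ≤ 2 := by
  obtain ⟨c, y, rfl⟩ | hx := x.cases_tag
  · have := h₁ y
    have := h₂ y
    cases c <;> simp [cnt_map_tag, LTp.cnt_tag] <;> omega
  · simp [cnt_map_tag_of_ne hx, LTp.cnt_tag_of_ne hx]

/-- In a tagged thin sequent there is room for a bracket with the empty label. -/
theorem Thin.tag_add_indic {Γ : List (Tok LTp)} {A : LTp} (h : Thin Γ A) (x : Letter) :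
    cnt x (Γ.map (Tok.tag true)) + (A.tag true).cnt x +
      2 * (indic x (.opn []) + indic x (.cls [])) ≤ 2 := by
  obtain ⟨c, y, rfl⟩ | hx := x.cases_tag
  · have := h y
    have h₁ : indic (y.tag c) (.opn []) = 0 := by cases y <;> simp [indic, Letter.tag]
    have h₂ : indic (y.tag c) (.cls []) = 0 := by cases y <;> simp [indic, Letter.tag]
    cases c <;> simp [cnt_map_tag, LTp.cnt_tag, h₁, h₂]
    omega
  · cases x <;> simp [cnt_map_tag_of_ne hx, LTp.cnt_tag_of_ne hx, indic] <;> split <;> simp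

theorem exists_of_map_erase_eq {Θ : List (Tok LTp)} {l r : List (Tok Tp)} {B : Tp}
    (h : Θ.map Tok.erase = l ++ ty B :: r) :
    ∃ l' B' r', Θ = l' ++ ty B' :: r' ∧ l'.map Tok.erase = l ∧ B'.erase = B ∧
      r'.map Tok.erase = r := by
  obtain ⟨l', m, rfl, hl, hm⟩ := List.map_eq_append_iff.1 h
  obtain ⟨t, r', rfl, ht, hr⟩ := List.map_eq_cons_iff.1 hm
  cases t with
  | ty B' =>
    simp only [Tok.erase_ty, Tok.ty.injEq] at ht
    exact ⟨l', B', r', rfl, hl, ht, hr⟩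
  | op a => simp at ht
  | cl a => simp at ht

theorem exists_of_map_erase_eq_bracket {Θ : List (Tok LTp)} {l m r : List (Tok Tp)}
    (h : Θ.map Tok.erase = l ++ op [] :: (m ++ cl [] :: r)) :
    ∃ l' a m' b r', Θ = l' ++ op a :: (m' ++ cl b :: r') ∧ l'.map Tok.erase = l ∧
      m'.map Tok.erase = m ∧ r'.map Tok.erase = r := by
  obtain ⟨l', n, rfl, hl, hn⟩ := List.map_eq_append_iff.1 h
  obtain ⟨t, n, rfl, ht, hn⟩ := List.map_eq_cons_iff.1 hn
  obtain ⟨m', n, rfl, hm, hn⟩ := List.map_eq_append_iff.1 hn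
  obtain ⟨t', r', rfl, ht', hr⟩ := List.map_eq_cons_iff.1 hn
  cases t <;> cases t' <;> simp at ht ht'
  exact ⟨l', _, m', _, r', rfl, hl, hm, hr⟩

theorem balanced_of_map_erase {l : List (Tok LTp)} (h : Balanced (l.map Tok.erase)) :
    Balanced l :=
  ⟨by rw [← height_map_erase, h.1], fun p s hp => by
    rw [← height_map_erase]; exact h.2 _ (s.map Tok.erase) (by simp [hp])⟩

/-- Every provable sequent is obtained from a thin one by erasing labels. In rules with two premises
the labels of the premises are made disjoint by tags, and modalities get the empty label. -/
theorem CutFree.exists_thin {S : Set Tp} (hS : SubClosed S) {Γ : Hedge} {C : Tp}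
    (h : CutFree Γ C) (hΓ : ∀ A ∈ Γ.yield, A ∈ S) (hC : C ∈ S) :
    ∃ Θ D, LProvable S Θ D ∧ Θ.map Tok.erase = Γ.flatten ∧ D.erase = C ∧ Thin Θ D := by
  induction h with
  | init i =>
    refine ⟨[ty (.prim i [])], .prim i [], .init i _ hC, rfl, rfl, fun x => ?_⟩
    simp only [cnt_ty, LTp.cnt, indic, cnt_nil]
    split <;> simp
  | underL u Γ A B C _ _ ih₁ ih₂ =>
    have hm := mem_of_mem_yield_fill hΓ
    simp only [yield_append, yield_single, List.mem_append, List.mem_singleton] at hm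
    have hAB := hS.under (hm _ (.inr rfl))
    obtain ⟨Θ, A, h₁, hΘ, rfl, ht₁⟩ := ih₁ (fun A hA => hm A (.inl hA)) hAB.1
    obtain ⟨Λ, C, h₂, hΛ, rfl, ht₂⟩ := ih₂ (forall_mem_yield_fill hΓ (by simpa using hAB.2)) hC
    obtain ⟨l', r', hu⟩ := u.exists_flatten_fill
    obtain ⟨l, B, r, rfl, rfl, rfl, rfl⟩ := exists_of_map_erase_eq (by simpa [hu] using hΛ)
    refine ⟨_, _, .underL _ _ _ _ _ _ (h₁.tag true) (by simpa using h₂.tag false),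
      by simp [hu, hΘ, LTp.erase], by simp, fun x => ?_⟩
    have := ht₁.tag_add ht₂ x
    simp [LTp.cnt] at this ⊢
    omega
  | underR Γ A B _ ih =>
    obtain ⟨Θ, B, h, hΘ, rfl, ht⟩ := ih (by simpa using ⟨(hS.under hC).1, hΓ⟩) (hS.under hC).2
    obtain ⟨l, A, r, rfl, hl, rfl, hr⟩ := exists_of_map_erase_eq (l := []) (r := Γ.flatten)
      (by simpa using hΘ)
    obtain rfl := List.map_eq_nil_iff.1 hl
    refine ⟨r, .under A B, .underR _ _ _ h, hr, rfl, fun x => ?_⟩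
    have := ht x
    simp [LTp.cnt] at this ⊢
    omega
  | overL u Γ A B C _ _ ih₁ ih₂ =>
    have hm := mem_of_mem_yield_fill hΓ
    simp only [yield_append, yield_single, List.mem_append, List.mem_singleton] at hm
    have hAB := hS.quot (hm _ (.inl rfl))
    obtain ⟨Θ, A, h₁, hΘ, rfl, ht₁⟩ := ih₁ (fun A hA => hm A (.inr hA)) hAB.2
    obtain ⟨Λ, C, h₂, hΛ, rfl, ht₂⟩ := ih₂ (forall_mem_yield_fill hΓ (by simpa using hAB.1)) hC
    obtain ⟨l', r', hu⟩ := u.exists_flatten_fill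
    obtain ⟨l, B, r, rfl, rfl, rfl, rfl⟩ := exists_of_map_erase_eq (by simpa [hu] using hΛ)
    refine ⟨_, _, .overL _ _ _ _ _ _ (h₁.tag true) (by simpa using h₂.tag false),
      by simp [hu, hΘ, LTp.erase], by simp, fun x => ?_⟩
    have := ht₁.tag_add ht₂ x
    simp [LTp.cnt] at this ⊢
    omega
  | overR Γ A B _ ih =>
    obtain ⟨Θ, B, h, hΘ, rfl, ht⟩ := ih (by
      simp only [yield_append, yield_single, List.mem_append, List.mem_singleton]
      rintro D (hD | rfl)
      exacts [hΓ D hD, (hS.quot hC).2]) (hS.quot hC).1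
    obtain ⟨l, A, r, rfl, hl, rfl, hr⟩ := exists_of_map_erase_eq (l := Γ.flatten) (r := [])
      (by simpa using hΘ)
    obtain rfl := List.map_eq_nil_iff.1 hr
    refine ⟨l, .quot B A, .overR _ _ _ h, hl, rfl, fun x => ?_⟩
    have := ht x
    simp [LTp.cnt] at this ⊢
    omega
  | prodL u A B C _ ih =>
    have hAB := hS.prod (mem_of_mem_yield_fill hΓ (.prod A B) (by simp))
    obtain ⟨Λ, C, h, hΛ, rfl, ht⟩ := ih (forall_mem_yield_fill hΓ (by simpa using hAB)) hC
    obtain ⟨l', r', hu⟩ := u.exists_flatten_fill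
    obtain ⟨l, A, r, rfl, rfl, rfl, hr⟩ := exists_of_map_erase_eq (l := l') (B := A)
      (r := ty B :: r') (by simpa [hu] using hΛ)
    obtain ⟨m, B, r, rfl, hm, rfl, rfl⟩ := exists_of_map_erase_eq (l := []) hr
    obtain rfl := List.map_eq_nil_iff.1 hm
    refine ⟨_, C, .prodL l r A B C h, by simp [hu, LTp.erase], rfl, fun x => ?_⟩
    have := ht x
    simp [LTp.cnt] at this ⊢
    omega
  | prodR Γ Δ A B _ _ ih₁ ih₂ =>
    simp only [yield_append, List.mem_append] at hΓ
    obtain ⟨Θ, A, h₁, hΘ, rfl, ht₁⟩ := ih₁ (fun A hA => hΓ A (.inl hA)) (hS.prod hC).1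
    obtain ⟨Λ, B, h₂, hΛ, rfl, ht₂⟩ := ih₂ (fun A hA => hΓ A (.inr hA)) (hS.prod hC).2
    refine ⟨_, _, .prodR _ _ _ _ (h₁.tag true) (h₂.tag false), by simp [hΘ, hΛ],
      by simp [LTp.erase], fun x => ?_⟩
    have := ht₁.tag_add ht₂ x
    simp [LTp.cnt] at this ⊢
    omega
  | diaL u A C _ ih =>
    have hA := hS.dia (mem_of_mem_yield_fill hΓ (.dia A) (by simp))
    obtain ⟨Λ, C, h, hΛ, rfl, ht⟩ := ih (forall_mem_yield_fill hΓ (by simpa using hA)) hC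
    obtain ⟨l', r', hu⟩ := u.exists_flatten_fill
    obtain ⟨l, a, m, b, r, rfl, rfl, hm, rfl⟩ := exists_of_map_erase_eq_bracket (l := l')
      (m := [ty A]) (r := r') (by simpa [hu] using hΛ)
    obtain ⟨m₁, A, m₂, rfl, hm₁, rfl, hm₂⟩ := exists_of_map_erase_eq (l := []) hm
    obtain rfl := List.map_eq_nil_iff.1 hm₁
    obtain rfl := List.map_eq_nil_iff.1 hm₂
    refine ⟨_, C, .diaL l r a b A C h, by simp [hu, LTp.erase], rfl, fun x => ?_⟩
    have := ht x
    simp [LTp.cnt] at this ⊢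
    omega
  | diaR Γ A hp ih =>
    obtain ⟨Θ, A, h, hΘ, rfl, ht⟩ := ih (by simpa using hΓ) (hS.dia hC)
    by_cases hne : Θ = []
    · -- The succedent of an empty bracket becomes a constant.
      subst hne
      obtain rfl : Γ = .nil := flatten_injective hΘ.symm
      refine ⟨_, _, .closedR [] [] A.erase (hS.dia hC) hp.provable, rfl, rfl, fun x => ?_⟩
      cases x <;> simp [LTp.cnt, indic] <;> split <;> simp
    · refine ⟨_, _, .diaR _ [] [] _ (by simpa using hne) (h.tag true), by simp [hΘ],
        by simp [LTp.erase], fun x => ?_⟩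
      have := ht.tag_add_indic x
      simp [LTp.cnt] at this ⊢
      omega
  | boxL u A C _ ih =>
    have hA := mem_of_mem_yield_fill hΓ (.box A) (by simp)
    obtain ⟨Λ, C, h, hΛ, rfl, ht⟩ := ih (forall_mem_yield_fill hΓ (by simpa using hS.box hA)) hC
    obtain ⟨l', r', hu⟩ := u.exists_flatten_fill
    obtain ⟨l, A, r, rfl, rfl, rfl, rfl⟩ := exists_of_map_erase_eq (by simpa [hu] using hΛ)
    refine ⟨_, _, .boxL _ _ [] [] _ _ (by simpa using h.tag true), by simp [hu, LTp.erase],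
      by simp, fun x => ?_⟩
    have := ht.tag_add_indic x
    simp [LTp.cnt] at this ⊢
    omega
  | boxR Γ A _ ih =>
    obtain ⟨Θ, A, h, hΘ, rfl, ht⟩ := ih (by simpa using hΓ) (hS.box hC)
    obtain ⟨l, a, m, b, r, rfl, hl, hm, hr⟩ := exists_of_map_erase_eq_bracket (l := [])
      (m := Γ.flatten) (r := []) (by simpa using hΘ)
    obtain rfl := List.map_eq_nil_iff.1 hl
    obtain rfl := List.map_eq_nil_iff.1 hr
    refine ⟨m, _, .boxR _ a b _ (balanced_of_map_erase (hm ▸ Γ.balanced_flatten)) h, hm, rfl,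
      fun x => ?_⟩
    have := ht x
    simp [LTp.cnt] at this ⊢
    omega

end LStarDiamond

/-! ### Types of bounded length -/

namespace LStarDiamond

open Tok Hedge

/-- Types built in at most `n` stages from the types in `S` and the types `◇ D` with `D ∈ S`. -/
def bounded (S : Set Tp) : ℕ → Set Tp
  | 0 => ∅
  | n + 1 => bounded S n ∪ S ∪ Tp.dia '' S ∪
      Set.image2 Tp.under (bounded S n) (bounded S n) ∪
      Set.image2 Tp.over (bounded S n) (bounded S n) ∪
      Set.image2 Tp.prod (bounded S n) (bounded S n) ∪
      Tp.dia '' bounded S n ∪ Tp.box '' bounded S n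

theorem finite_bounded {S : Set Tp} (hS : S.Finite) (n : ℕ) : (bounded S n).Finite := by
  induction n with
  | zero => exact Set.finite_empty
  | succ n ih =>
    exact ((((((ih.union hS).union (hS.image _)).union (ih.image2 _ ih)).union
      (ih.image2 _ ih)).union (ih.image2 _ ih)).union (ih.image _)).union (ih.image _)

namespace LTp

theorem size_pos (A : LTp) : 0 < A.size := by
  induction A <;> simp_all [size, word]

/-- There are finitely many types over `S` of bounded length, up to labels: every constructor either
adds to the length or joins two types of positive length. -/
theorem erase_mem_bounded {S : Set Tp} (n : ℕ) :
    ∀ A : LTp, A.Over S → A.size ≤ n → A.erase ∈ bounded S n := by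
  induction n with
  | zero => intro A _ h; have := A.size_pos; omega
  | succ n ih =>
    intro A hA hn
    simp only [bounded, Set.mem_union, Set.mem_image, Set.mem_image2]
    cases A with
    | prim i a => tauto
    | under A B =>
      have hs : (under A B).size = A.size + B.size := by simp [size, word]
      have := A.size_pos
      have := B.size_pos
      exact .inl <| .inl <| .inl <| .inl <| .inr
        ⟨_, ih A hA.1 (by omega), _, ih B hA.2 (by omega), rfl⟩
    | quot B A =>
      have hs : (quot B A).size = B.size + A.size := by simp [size, word]
      have := A.size_pos
      have := B.size_pos
      exact .inl <| .inl <| .inl <| .inr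
        ⟨_, ih B hA.1 (by omega), _, ih A hA.2 (by omega), rfl⟩
    | prod A B =>
      have hs : (prod A B).size = A.size + B.size := by simp [size, word]
      have := A.size_pos
      have := B.size_pos
      exact .inl <| .inl <| .inr
        ⟨_, ih A hA.1 (by omega), _, ih B hA.2 (by omega), rfl⟩
    | dia a b A =>
      simp only [size, word, List.length_append, List.length_cons] at hn
      exact .inl <| .inr ⟨_, ih A hA (by simp only [size]; omega), rfl⟩
    | box a b A =>
      simp only [size, word, List.length_append, List.length_cons] at hn
      exact .inr ⟨_, ih A hA (by simp only [size]; omega), rfl⟩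
    | closed a b D => exact .inl <| .inl <| .inl <| .inl <| .inl <| .inr ⟨D, hA, rfl⟩

theorem over_of_erase_mem {S : Set Tp} (hS : SubClosed S) {A : LTp} (h : A.erase ∈ S) :
    A.Over S := by
  induction A with
  | prim i a => exact h
  | under A B ihA ihB => exact ⟨ihA (hS.under h).1, ihB (hS.under h).2⟩
  | quot B A ihB ihA => exact ⟨ihB (hS.quot h).1, ihA (hS.quot h).2⟩
  | prod A B ihA ihB => exact ⟨ihA (hS.prod h).1, ihB (hS.prod h).2⟩
  | dia a b A ih => exact ih (hS.dia h)
  | box a b A ih => exact ih (hS.box h)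
  | closed a b D => exact hS.dia h

end LTp

/-- The length of a type: primitive types count once, modalities twice. -/
def Tp.size : Tp → ℕ
  | .prim _ => 1
  | .under A B => A.size + B.size
  | .over B A => B.size + A.size
  | .prod A B => A.size + B.size
  | .dia A => A.size + 2
  | .box A => A.size + 2

theorem LTp.size_le (A : LTp) : A.size ≤ A.erase.size := by
  induction A <;> simp_all [size, word, erase, Tp.size] <;> omega

/-- The set of subtypes of a type. -/
def Tp.subtypes : Tp → Set Tp
  | .prim i => {.prim i}
  | .under A B => insert (.under A B) (A.subtypes ∪ B.subtypes)
  | .over B A => insert (.over B A) (B.subtypes ∪ A.subtypes)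
  | .prod A B => insert (.prod A B) (A.subtypes ∪ B.subtypes)
  | .dia A => insert (.dia A) A.subtypes
  | .box A => insert (.box A) A.subtypes

theorem Tp.self_mem_subtypes (A : Tp) : A ∈ A.subtypes := by
  induction A <;> simp [subtypes]

theorem Tp.finite_subtypes (A : Tp) : A.subtypes.Finite := by
  induction A <;> simp_all [subtypes]

theorem Tp.subClosed_subtypes (A : Tp) : SubClosed A.subtypes := by
  have key : ∀ B ∈ A.subtypes, B.subtypes ⊆ A.subtypes := by
    induction A with
    | prim i => rintro B rfl; exact subset_rfl
    | under C D ihC ihD =>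
      rintro B (rfl | hB | hB)
      · exact subset_rfl
      · exact (ihC B hB).trans fun x hx => .inr (.inl hx)
      · exact (ihD B hB).trans fun x hx => .inr (.inr hx)
    | quot C D ihC ihD =>
      rintro B (rfl | hB | hB)
      · exact subset_rfl
      · exact (ihC B hB).trans fun x hx => .inr (.inl hx)
      · exact (ihD B hB).trans fun x hx => .inr (.inr hx)
    | prod C D ihC ihD =>
      rintro B (rfl | hB | hB)
      · exact subset_rfl
      · exact (ihC B hB).trans fun x hx => .inr (.inl hx)
      · exact (ihD B hB).trans fun x hx => .inr (.inr hx)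
    | dia C ih =>
      rintro B (rfl | hB)
      · exact subset_rfl
      · exact (ih B hB).trans fun x hx => .inr hx
    | box C ih =>
      rintro B (rfl | hB)
      · exact subset_rfl
      · exact (ih B hB).trans fun x hx => .inr hx
  constructor
  · exact fun {B C} h => ⟨key _ h (.inr (.inl B.self_mem_subtypes)),
      key _ h (.inr (.inr C.self_mem_subtypes))⟩
  · exact fun {B C} h => ⟨key _ h (.inr (.inl C.self_mem_subtypes)),
      key _ h (.inr (.inr B.self_mem_subtypes))⟩
  · exact fun {B C} h => ⟨key _ h (.inr (.inl B.self_mem_subtypes)),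
      key _ h (.inr (.inr C.self_mem_subtypes))⟩
  · exact fun {B} h => key _ h (.inr B.self_mem_subtypes)
  · exact fun {B} h => key _ h (.inr B.self_mem_subtypes)

theorem SubClosed.biUnion {T : Set Tp} : SubClosed (⋃ A ∈ T, A.subtypes) := by
  constructor
  all_goals
    intros
    rename_i h
    obtain ⟨A, hA, h⟩ := Set.mem_iUnion₂.1 h
  · exact ⟨Set.mem_iUnion₂.2 ⟨A, hA, (A.subClosed_subtypes.under h).1⟩,
      Set.mem_iUnion₂.2 ⟨A, hA, (A.subClosed_subtypes.under h).2⟩⟩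
  · exact ⟨Set.mem_iUnion₂.2 ⟨A, hA, (A.subClosed_subtypes.quot h).1⟩,
      Set.mem_iUnion₂.2 ⟨A, hA, (A.subClosed_subtypes.quot h).2⟩⟩
  · exact ⟨Set.mem_iUnion₂.2 ⟨A, hA, (A.subClosed_subtypes.prod h).1⟩,
      Set.mem_iUnion₂.2 ⟨A, hA, (A.subClosed_subtypes.prod h).2⟩⟩
  · exact Set.mem_iUnion₂.2 ⟨A, hA, A.subClosed_subtypes.dia h⟩
  · exact Set.mem_iUnion₂.2 ⟨A, hA, A.subClosed_subtypes.box h⟩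

/-! ### The context-free grammar -/

theorem forall₂_append_left {β γ : Type*} {R : β → γ → Prop} {l m : List β} {v : List γ}
    (h : List.Forall₂ R (l ++ m) v) :
    ∃ v₁ v₂, v = v₁ ++ v₂ ∧ List.Forall₂ R l v₁ ∧ List.Forall₂ R m v₂ := by
  induction l generalizing v with
  | nil => exact ⟨[], v, rfl, .nil, h⟩
  | cons b l ih =>
    obtain ⟨c, v, hbc, hlv, rfl⟩ := List.forall₂_cons_left_iff.1 h
    obtain ⟨v₁, v₂, rfl, h₁, h₂⟩ := ih hlv
    exact ⟨c :: v₁, v₂, rfl, .cons hbc h₁, h₂⟩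

variable {α : Type*}

/-- The rules of the grammar with nonterminals in `N`: a nonterminal is rewritten to a string of at
most two nonterminals if it is provable from some hedge with this string as its yield, and to a
letter according to the lexicon. -/
def ruleSet (N : Set Tp) (I : Set (α × Tp)) : Set (ContextFreeRule α Tp) :=
  {r | r.input ∈ N ∧ ∃ l : List Tp, (∀ A ∈ l, A ∈ N) ∧ l.length ≤ 2 ∧
    r.output = l.map .nonterminal ∧ ∃ Γ : Hedge, Provable Γ r.input ∧ Γ.yield = l} ∪
  {r | ∃ p ∈ I, r = ⟨p.2, [.terminal p.1]⟩}

theorem finite_ruleSet {N : Set Tp} (hN : N.Finite) {I : Set (α × Tp)} (hI : I.Finite) :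
    (ruleSet N I).Finite := by
  refine Set.Finite.union ?_ ?_
  · have hl : ({[]} ∪ (fun A => [Symbol.nonterminal A]) '' N ∪
        Set.image2 (fun A B => [Symbol.nonterminal A, .nonterminal B]) N N :
        Set (List (Symbol α Tp))).Finite :=
      ((Set.finite_singleton _).union (hN.image _)).union (hN.image2 _ hN)
    refine (hN.image2 ContextFreeRule.mk hl).subset ?_
    rintro ⟨A, w⟩ ⟨hA, l, hl, hlen, rfl, -⟩
    refine ⟨A, hA, _, ?_, rfl⟩
    match l, hlen, hl with
    | [], _, _ => exact .inl (.inl rfl)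
    | [B], _, hl => exact .inl (.inr ⟨B, hl B (by simp), rfl⟩)
    | [B, C], _, hl => exact .inr ⟨B, hl B (by simp), C, hl C (by simp), rfl⟩
  · refine (hI.image fun p => (⟨p.2, [.terminal p.1]⟩ : ContextFreeRule α Tp)).subset ?_
    rintro r ⟨p, hp, rfl⟩
    exact ⟨p, hp, rfl⟩

/-- The context-free grammar with nonterminals in `N`, a given lexicon, and start symbol `D`. -/
noncomputable def grammar {N : Set Tp} (hN : N.Finite) {I : Set (α × Tp)} (hI : I.Finite)
    (D : Tp) : ContextFreeGrammar α where
  NT := Tp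
  initial := D
  rules := (finite_ruleSet hN hI).toFinset

/-- A symbol of the grammar stands for a type: nonterminals for themselves, letters according to
the lexicon. -/
def Matches (I : Set (α × Tp)) : Symbol α Tp → Tp → Prop
  | .terminal a, A => (a, A) ∈ I
  | .nonterminal B, A => A = B

theorem forall₂_matches_nonterminal {I : Set (α × Tp)} (l : List Tp) :
    List.Forall₂ (Matches I) (l.map .nonterminal) l := by
  induction l with
  | nil => exact .nil
  | cons A l ih => exact .cons rfl ih

section

variable {N : Set Tp} (hN : N.Finite) {I : Set (α × Tp)} (hI : I.Finite) (D : Tp)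

/-- Soundness of the grammar: its sentential forms are yields of provable hedges. -/
theorem exists_provable_of_derives {s : List (Symbol α Tp)}
    (h : (grammar hN hI D).Derives [.nonterminal D] s) :
    ∃ Γ : Hedge, Provable Γ D ∧ List.Forall₂ (Matches I) s Γ.yield := by
  induction h with
  | refl => exact ⟨single D, .refl D, .cons rfl .nil⟩
  | tail _ hstep ih =>
    obtain ⟨Γ, hΓ, hm⟩ := ih
    obtain ⟨r, hr, hstep⟩ := hstep
    have hr : r ∈ ruleSet N I := (Set.Finite.mem_toFinset _).1 hr
    obtain ⟨p, q, rfl, rfl⟩ := hstep.exists_parts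
    obtain ⟨y', z, hy, hm, hq⟩ := forall₂_append_left hm
    obtain ⟨y, v, rfl, hp, hv⟩ := forall₂_append_left hm
    obtain ⟨A, v, hA, hnil, rfl⟩ := List.forall₂_cons_left_iff.1 hv
    obtain rfl := List.forall₂_nil_left_iff.1 hnil
    obtain rfl : A = r.input := hA
    obtain ⟨-, l, -, -, ho, Δ, hΔ, rfl⟩ | ⟨p, hp, rfl⟩ := hr
    · obtain ⟨u, rfl, hu⟩ := Γ.exists_fill_of_yield y z _
        (hy.trans (List.append_assoc y [r.input] z))
      refine ⟨u.fill Δ, .cut u _ _ _ hΔ hΓ, ?_⟩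
      rw [hu, ho]
      exact List.rel_append (List.rel_append hp (forall₂_matches_nonterminal _)) hq
    · refine ⟨Γ, hΓ, ?_⟩
      rw [hy]
      exact List.rel_append (List.rel_append ‹_› (.cons ‹_› .nil)) hq

theorem derives_of_provable {A : Tp} {Γ : Hedge} (h : Provable Γ A) (hA : A ∈ N)
    (hΓ : ∀ B ∈ Γ.yield, B ∈ N) (hlen : Γ.yield.length ≤ 2) :
    (grammar hN hI D).Derives [.nonterminal A] (Γ.yield.map .nonterminal) := by
  refine ContextFreeGrammar.Produces.single
    ⟨⟨A, Γ.yield.map .nonterminal⟩, ?_, ContextFreeRule.Rewrites.input_output⟩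
  exact (Set.Finite.mem_toFinset _).2 (.inl ⟨hA, _, hΓ, hlen, rfl, Γ, h, rfl⟩)

theorem derives_append_map {l m : List Tp} (p q : List Tp)
    (h : (grammar hN hI D).Derives (l.map .nonterminal) (m.map .nonterminal)) :
    (grammar hN hI D).Derives ((p ++ l ++ q).map .nonterminal)
      ((p ++ m ++ q).map .nonterminal) := by
  have e : ∀ l : List Tp, ((p ++ l ++ q).map .nonterminal : List (Symbol α Tp)) =
      p.map .nonterminal ++ l.map .nonterminal ++ q.map .nonterminal := by simp
  convert (h.append_left (p.map .nonterminal)).append_right (q.map .nonterminal) using 1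
  exacts [e l, e m]

theorem derives_terminal {a : α} {A : Tp} (h : (a, A) ∈ I) :
    (grammar hN hI D).Derives [.nonterminal A] [.terminal a] := by
  refine ContextFreeGrammar.Produces.single
    ⟨⟨A, [.terminal a]⟩, ?_, ContextFreeRule.Rewrites.input_output⟩
  exact (Set.Finite.mem_toFinset _).2 (.inr ⟨(a, A), h, rfl⟩)

theorem balanced_map_ty {β : Type} (l : List β) : Balanced (l.map ty) := by
  induction l with
  | nil => exact balanced_nil
  | cons A l ih => exact (balanced_ty A).append ih

theorem value_map_ty (l : List LTp) : value (l.map ty) = (l.map LTp.value).prod := by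
  induction l with
  | nil => rfl
  | cons A l ih => simp [ih]

/-- Completeness of the grammar for bracket-free sequents: as long as a thin sequent has at least
three types in the antecedent, Pentus's lemma yields a segment that has a short interpolant. -/
theorem LProvable.derives {S : Set Tp} {m : ℕ}
    (hSN : ∀ A : LTp, A.Over S → A.size ≤ m → A.erase ∈ N) (n : ℕ) :
    ∀ (l : List LTp) (C : LTp), l.length ≤ n → LProvable S (l.map ty) C → Thin (l.map ty) C →
      (∀ A ∈ l, A.Over S ∧ A.size ≤ m) → C.Over S → C.size ≤ m →
      (grammar hN hI D).Derives [.nonterminal C.erase]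
        ((l.map LTp.erase).map .nonterminal) := by
  have base : ∀ (l : List LTp) (C : LTp), l.length ≤ 2 → LProvable S (l.map ty) C →
      (∀ A ∈ l, A.Over S ∧ A.size ≤ m) → C.Over S → C.size ≤ m →
      (grammar hN hI D).Derives [.nonterminal C.erase]
        ((l.map LTp.erase).map .nonterminal) := by
    intro l C hlen h hl hC hm
    obtain ⟨Θ, hΘ, hp⟩ := h.exists_provable
    obtain rfl : Θ = ofList (l.map LTp.erase) :=
      flatten_injective (by simp [hΘ, Function.comp_def])
    have := derives_of_provable hN hI D hp (hSN C hC hm)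
      (by simpa using fun A hA => hSN A (hl A hA).1 (hl A hA).2) (by simpa using hlen)
    simpa using this
  induction n with
  | zero => exact fun l C hlen h _ hl hC hm => base l C (by omega) h hl hC hm
  | succ n ih =>
    intro l C hlen h ht hl hC hm
    by_cases hl2 : l.length ≤ 2
    · exact base l C hl2 h hl hC hm
    have hval := h.value_eq
    rw [value_map_ty] at hval
    obtain ⟨p, x, y, q, hpq, hxy⟩ := FreeGroup.exists_norm_mul_le
      (l.map LTp.value ++ [C.value⁻¹]) (by simp; omega) (by simp [hval])
    rcases q.eq_nil_or_concat with rfl | ⟨q, z, rfl⟩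
    · -- The short product is that of the last type and the succedent.
      have hpq' : l.map LTp.value ++ [C.value⁻¹] = (p ++ [x]) ++ [y] := by simpa using hpq
      obtain ⟨h₁, h₂⟩ := List.append_inj' hpq' rfl
      obtain ⟨P, Q, rfl, rfl, hQ⟩ := List.map_eq_append_iff.1 h₁
      obtain ⟨A, R, rfl, rfl, hR⟩ := List.map_eq_cons_iff.1 hQ
      obtain rfl := List.map_eq_nil_iff.1 hR
      obtain rfl : C.value⁻¹ = y := by simpa using h₂
      have hP : P ≠ [] := by rintro rfl; simp at hl2
      obtain ⟨E, hE, hE₁, hE₂, hE₃⟩ := h.interpolable [] (P.map ty) [ty A] (by simp)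
        (balanced_map_ty P) (by simpa using hP)
      have hthin : Thin (P.map ty) E := fun x => by
        have := ht x
        have := hE₃ x
        simp at *
        omega
      have hEsize : E.size ≤ m := by
        rw [LTp.size_eq_norm fun x => by
          have := ht x
          have := hE₃ x
          simp at *
          omega]
        have hv := hE₂.value_eq
        have hEv : E.value = (A.value * C.value⁻¹)⁻¹ := by
          simp only [List.nil_append, value_ty, value_nil, mul_one] at hv
          rw [← hv]
          group
        rw [hEv, FreeGroup.norm_inv_eq]
        refine hxy.trans (max_le ?_ ?_)
        · exact A.norm_value_le.trans (hl A (by simp)).2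
        · rw [FreeGroup.norm_inv_eq]
          exact C.norm_value_le.trans hm
      have hd₁ := base [E, A] C (by simp) hE₂
        (by simpa using ⟨⟨hE, hEsize⟩, hl A (by simp)⟩) hC hm
      have hd₂ := ih P E (by simp at hlen; omega) hE₁ hthin (fun B hB => hl B (by simp [hB]))
        hE hEsize
      refine hd₁.trans ?_
      simpa using derives_append_map hN hI D (l := [E.erase]) [] [A.erase] hd₂
    · -- The short product is that of two neighbours in the antecedent.
      have hpq' : l.map LTp.value ++ [C.value⁻¹] = (p ++ x :: y :: q) ++ [z] := by
        simpa using hpq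
      obtain ⟨h₁, -⟩ := List.append_inj' hpq' rfl
      obtain ⟨P, Q, rfl, rfl, hQ⟩ := List.map_eq_append_iff.1 h₁
      obtain ⟨A, R, rfl, rfl, hR⟩ := List.map_eq_cons_iff.1 hQ
      obtain ⟨B, Q, rfl, rfl, rfl⟩ := List.map_eq_cons_iff.1 hR
      obtain ⟨E, hE, hE₁, hE₂, hE₃⟩ := h.interpolable (P.map ty) [ty A, ty B] (Q.map ty)
        (by simp) (balanced_map_ty [A, B]) (by simp)
      have hthin : Thin ((P ++ E :: Q).map ty) C := fun x => by
        have := ht x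
        have := hE₃ x
        simp at *
        omega
      have hEsize : E.size ≤ m := by
        rw [LTp.size_eq_norm fun x => by
          have := ht x
          have := hE₃ x
          simp at *
          omega]
        have hv := hE₁.value_eq
        simp only [value_ty, value_nil, mul_one] at hv
        rw [← hv]
        exact hxy.trans (max_le (A.norm_value_le.trans (hl A (by simp)).2)
          (B.norm_value_le.trans (hl B (by simp)).2))
      have hd₁ := base [A, B] E (by simp) hE₁
        (by simpa using ⟨hl A (by simp), hl B (by simp)⟩) hE hEsize
      have hd₂ := ih (P ++ E :: Q) C (by simp at hlen ⊢; omega) (by simpa using hE₂) hthin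
        (by
          simp only [List.mem_append, List.mem_cons]
          rintro F (hF | rfl | hF)
          exacts [hl F (by simp [hF]), ⟨hE, hEsize⟩, hl F (by simp [hF])]) hC hm
      refine hd₂.trans ?_
      simpa using derives_append_map hN hI D (l := [E.erase]) (P.map LTp.erase) (Q.map LTp.erase)
        hd₁

variable {S : Set Tp} {m : ℕ} (hS : SubClosed S) (hSm : ∀ A ∈ S, A.size ≤ m)
  (hSN : ∀ A : LTp, A.Over S → A.size ≤ m → A.erase ∈ N) (hmem : S ⊆ N)

include hS hSm hSN in
theorem Provable.derives_ofList {l : List Tp} {C : Tp} (h : Provable (ofList l) C)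
    (hl : ∀ A ∈ l, A ∈ S) (hC : C ∈ S) :
    (grammar hN hI D).Derives [.nonterminal C] (l.map .nonterminal) := by
  obtain ⟨Θ, C, hΘC, hΘ, rfl, ht⟩ := h.cutFree.exists_thin hS (by simpa using hl) hC
  obtain ⟨l, rfl, rfl⟩ : ∃ l' : List LTp, Θ = l'.map ty ∧ l'.map LTp.erase = l := by
    rw [flatten_ofList] at hΘ
    clear h hΘC ht hl
    induction l generalizing Θ with
    | nil => exact ⟨[], by simpa using hΘ, rfl⟩
    | cons A l ih =>
      obtain ⟨m, A, r, rfl, hm, rfl, hr⟩ := exists_of_map_erase_eq (l := []) hΘ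
      obtain rfl := List.map_eq_nil_iff.1 hm
      obtain ⟨l', rfl, rfl⟩ := ih _ hr
      exact ⟨A :: l', rfl, rfl⟩
  have key : ∀ A : LTp, A.erase ∈ S → A.Over S ∧ A.size ≤ m := fun A hA =>
    ⟨A.over_of_erase_mem hS hA, A.size_le.trans (hSm _ hA)⟩
  exact hΘC.derives hN hI D hSN _ l C le_rfl ht (fun A hA => key A (hl _ (List.mem_map_of_mem hA)))
    (key C hC).1 (key C hC).2

include hS hSm hSN hmem in
theorem Reduces.derives {Γ : Hedge} {l : List Tp} (h : Reduces S Γ l)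
    (hΓ : ∀ A ∈ Γ.yield, A ∈ S) :
    (grammar hN hI D).Derives (l.map .nonterminal) (Γ.yield.map .nonterminal) := by
  induction h with
  | nil => exact .refl _
  | @typ A Γ l h ih =>
    exact (ih fun B hB => hΓ B (by simp [hB])).append_left [.nonterminal A]
  | @dia Δ Γ Λ l A h₁ hA hp h₂ ih₁ ih₂ =>
    have hd₁ := ih₁ fun B hB => hΓ B (by simp [hB])
    have hd₂ := ih₂ fun B hB => hΓ B (by simp [hB])
    have hp' := hp.derives_ofList hN hI D hS hSm hSN
      (h₁.mem hS fun B hB => hΓ B (by simp [hB])) (hS.dia hA)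
    have hr := derives_of_provable hN hI D (Γ := bracket (Hedge.single A)) (.diaR _ _ (.refl A))
      (hmem hA) (by simpa using hmem (hS.dia hA)) (by simp)
    have := derives_append_map hN hI D Δ.yield [] hd₂
    simp only [List.append_nil] at this
    exact (derives_append_map hN hI D (l := [_]) [] l (hr.trans (hp'.trans hd₁))).trans this
  | @box Δ Γ Λ l A h₁ hA hp h₂ ih₁ ih₂ =>
    have hd₁ := ih₁ fun B hB => hΓ B (by simp [hB])
    have hd₂ := ih₂ fun B hB => hΓ B (by simp [hB])
    have hp' := hp.derives_ofList hN hI D hS hSm hSN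
      (h₁.mem hS fun B hB => hΓ B (by simp [hB])) hA
    have hr := derives_of_provable hN hI D (Γ := bracket (Hedge.single (.box A)))
      (.boxL (.hole .nil .nil) _ _ (.refl A)) (hmem (hS.box hA))
      (by simpa using hmem hA) (by simp)
    have := derives_append_map hN hI D Δ.yield [] hd₂
    simp only [List.append_nil] at this
    exact (derives_append_map hN hI D (l := [_]) [] l (hr.trans (hp'.trans hd₁))).trans this

end

theorem exists_of_mem_of_forall₂ {β γ : Type*} {R : β → γ → Prop} {l : List β} {v : List γ}
    (h : List.Forall₂ R l v) {c : γ} (hc : c ∈ v) : ∃ b, R b c := by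
  induction h with
  | nil => simp at hc
  | cons hbc _ ih =>
    rcases List.mem_cons.1 hc with rfl | hc
    exacts [⟨_, hbc⟩, ih hc]

theorem derives_map_nonterminal {N : Set Tp} (hN : N.Finite) {I : Set (α × Tp)} (hI : I.Finite)
    (D : Tp) {w : List α} {l : List Tp} (h : List.Forall₂ (fun a A => (a, A) ∈ I) w l) :
    (grammar hN hI D).Derives (l.map .nonterminal) (w.map .terminal) := by
  induction h with
  | nil => exact .refl _
  | @cons a A w l hA _ ih =>
    exact ((derives_terminal hN hI D hA).append_right (l.map .nonterminal)).trans
      (ih.append_left [.terminal a])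

end LStarDiamond

open LStarDiamond in
theorem mainTheorem2 {α : Type*} [Finite α] (L : Language α)
    (hL : LStarDiamond.Recognized L) : L.IsContextFree := by
  obtain ⟨G, rfl⟩ := hL
  have hI := G.finite_lexicon
  let T : Set Tp := insert G.goal (Prod.snd '' G.lexicon)
  let S : Set Tp := ⋃ A ∈ T, A.subtypes
  have hTS : ∀ A ∈ T, A ∈ S := fun A hA => Set.mem_iUnion₂.2 ⟨A, hA, A.self_mem_subtypes⟩
  have hSfin : S.Finite := ((hI.image _).insert _).biUnion fun A _ => A.finite_subtypes
  obtain ⟨m, hm⟩ : ∃ m, ∀ A ∈ S, A.size ≤ m := by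
    obtain ⟨m, hm⟩ := (hSfin.image Tp.size).bddAbove
    exact ⟨m, fun A hA => hm ⟨A, hA, rfl⟩⟩
  have hN := finite_bounded hSfin (m + 1)
  have hS : SubClosed S := SubClosed.biUnion
  refine ⟨grammar hN hI G.goal, Set.ext fun w => ⟨fun hw => ?_, ?_⟩⟩
  · obtain ⟨Γ, hΓ, h⟩ := exists_provable_of_derives hN hI G.goal hw
    exact ⟨Γ, hΓ, List.forall₂_map_left_iff.1 h⟩
  · rintro ⟨Γ, hΓ, h⟩
    have hmem : ∀ A ∈ Γ.yield, A ∈ S := fun A hA => by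
      obtain ⟨a, ha⟩ := exists_of_mem_of_forall₂ h hA
      exact hTS A (.inr ⟨_, ha, rfl⟩)
    have hgoal : G.goal ∈ S := hTS _ (.inl rfl)
    obtain ⟨l, hl, hp⟩ := hΓ.cutFree.exists_reduces hS hmem hgoal
    have hSN : ∀ A : LTp, A.Over S → A.size ≤ m → A.erase ∈ bounded S (m + 1) := fun A hA h =>
      LTp.erase_mem_bounded (m + 1) A hA (h.trans m.le_succ)
    have hSsub : S ⊆ bounded S (m + 1) := fun A hA => by simp [bounded, hA]
    exact ((hp.derives_ofList hN hI G.goal hS hm hSN (hl.mem hS hmem) hgoal).trans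
      (hl.derives hN hI G.goal hS hm hSN hSsub hmem)).trans (derives_map_nonterminal hN hI G.goal h)
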